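/- **Setup.** Let $b\ge 2$ be an integer and let $\varepsilon>0$. Let $\eta,\theta:\mathbb R\to[0,\infty)$ be smooth, with $\eta$ supported on $[\tfrac14,4]$, $\eta\ge 1$ on $[\tfrac12,1]$, and $\theta$ even, supported on $[-2b,2b]$, $\theta\ge1$ on $[-b,b]$. Write $e(x)=e^{2\pi i x}$, $e_s(x)=e(x/s)$ and $\widehat\theta(\xi)=\int_{\mathbb R}\theta(t)e(-\xi t)\,dt$. Let $X=b^L$ with $L\ge 0$ an integer, let $q=b^\lambda\le\sqrt X$ with $\lambda$ even, let $N\ge1$ be real with $N\ll\sqrt X$, put $M=X/N^2$, let $r$ be real with $X^{2\varepsilon}\ll r\ll qX^{\varepsilon}$, and let $\sigma\in\{1,-1\}$. Let $d_j(n)$ be the $j$-th base-$b$ digit of $n$, and for integers $0\le k<bX$ let $$\rho(k)=\sum_{0\le j\le L}d_j(k)b^{L-j},\qquad f(k)=\rho(k)+k,\qquad T(m,h)=\frac{h\rho(m)+hm}{qN^2}.$$ For a power $s$ of $b$ let $\rho_s(k)=\sum_{0\le j<\log_b s}d_j(k)b^{\log_b s-1-j}$. Finally let $$f_h(t)=\frac{\eta(t)}{t^2}\,\widehat\theta\!\left(\frac{Mh}{q^2t^2}\right),\qquad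 F_h(t)=\mathbf 1_{t>0}\,\sqrt t\;\frac{e(1/8)\,2^{2/3}\,t^{-2/3}}{\sqrt6}\,f_h\!\left(2^{1/3}t^{-1/3}\right).$$ **Statement.** Let $b\mid U\mid s\mid\sqrt q$ with $s,U$ powers of $b$, and let $\sum^{\sharp}$ denote summation over integers $1\le a\le q/s$, $1\le h\asymp qr/M$, $1\le n\asymp qr/N$ and residue classes $\ell$ modulo $\sqrt q$ with $(a\ell,q)=1$ and $n\ell^3\equiv-2\sigma ah\pmod{\sqrt q}$. Then, with $T=T(a+dq/s,h)$ and $\overline\ell$ the inverse of $\ell$ to the relevant modulus, $$\frac{MN}{(qr)^{3/2}}\sum\nolimits^{\sharp}\left|\sum_{0\le d<s}F_h\!\left(\frac{Nn}{qT}\right)e_s\!\left(\sigma hd\overline\ell^{2}\right)e\!\left(3T^{1/3}\Big(\frac{Nn}{2q}\Big)^{2/3}\right)\right|$$ $$\ll\; q\sqrt r\,X^{2\varepsilon}+\frac{MNX^{3\varepsilon}}{(qr)^{3/2}}\sup_{\substack{\gamma\in[0,1]\\ \xi\ll X^{2\varepsilon}/X}}\ \sum\nolimits^{\sharp}\ \mathscr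 U_U(a,h,\ell,n;\gamma,\xi)\,\mathscr V_U(a,h,\ell,n;\gamma,\xi),$$ where $$\mathscr U_U=\left|\sum_{0\le m<s/U}e_s\!\left(\sigma hm\overline\ell^{2}\right)e\!\left(\frac{h^{1/3}n^{2/3}f(qm/s)}{2^{2/3}q\,f(a)^{2/3}}\right)e\!\left(\xi f\!\left(\frac{qm}{s}\right)+\gamma\rho_s(m)\right)\right|,$$ $$\mathscr V_U=\left|\sum_{0\le c<U}e_U\!\left(\sigma hc\overline\ell^{2}\right)e\!\left(\frac{h^{1/3}n^{2/3}f(qc/U)}{2^{2/3}q\,f(a)^{2/3}}\right)e\!\left(\xi f\!\left(\frac{qc}{U}\right)+\gamma\rho_s\!\left(\frac{cs}{U}\right)\right)\right|.$$ Here the implied constants in the conditions $N\ll\sqrt X$, $X^{2\varepsilon}\ll r\ll qX^\varepsilon$, $h\asymp qr/M$, $n\asymp qr/N$ and $\xi\ll X^{2\varepsilon}/X$ are arbitrary fixed positive constants (the ranges of $h$ and $n$ being the same on both sides), and the implied constant in the conclusion depends only on these constants and on $b,\varepsilon,\eta,\theta$. -/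

import Mathlib

noncomputable section

namespace ReversalSum

open scoped FourierTransform

/-- The additive character `e(x) = exp(2 π i x)`. -/
def e (x : ℝ) : ℂ := Complex.exp (2 * Real.pi * Complex.I * (x : ℂ))

/-- The additive character `e_s(x) = e(x / s)` on residue classes modulo `s`. -/
def eMod (s : ℕ) (x : ZMod s) : ℂ := e ((x.val : ℝ) / (s : ℝ))

/-- The `j`-th digit of `n` in base `b`. -/
def digit (b j n : ℕ) : ℕ := n / b ^ j % b

/-- The reversal function `ρ`, reversing the first `L + 1` base-`b` digits of `n`. -/
def rho (b L n : ℕ) : ℕ := ∑ j ∈ Finset.range (L + 1), digit b j n * b ^ (L - j)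

/-- The function `f(n) = ρ(n) + n`. -/
def f (b L n : ℕ) : ℕ := rho b L n + n

/-- The truncated reversal `ρ_s`, reversing the first `log_b s` base-`b` digits of `k`
(`s` a power of `b`). -/
def rhoTrunc (b s k : ℕ) : ℕ :=
  ∑ j ∈ Finset.range (Nat.log b s), digit b j k * b ^ (Nat.log b s - 1 - j)

/-- The fixed smooth weights: `η, θ : ℝ → [0, ∞)` are smooth, `η` is supported on `[1/4, 4]` and
is at least `1` on `[1/2, 1]`; `θ` is even, supported on `[-2b, 2b]` and at least `1` on
`[-b, b]`. -/
structure IsWeightPair (b : ℕ) (η θ : ℝ → ℝ) : Prop where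
  smooth_eta : ContDiff ℝ (⊤ : ℕ∞) η
  smooth_theta : ContDiff ℝ (⊤ : ℕ∞) θ
  eta_nonneg : ∀ t, 0 ≤ η t
  theta_nonneg : ∀ t, 0 ≤ θ t
  eta_support : Function.support η ⊆ Set.Icc (1 / 4) 4
  theta_support : Function.support θ ⊆ Set.Icc (-(2 * (b : ℝ))) (2 * (b : ℝ))
  one_le_eta : ∀ t, 1 / 2 ≤ t → t ≤ 1 → 1 ≤ η t
  one_le_theta : ∀ t, |t| ≤ (b : ℝ) → 1 ≤ θ t
  theta_even : ∀ t, θ (-t) = θ t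

/-- `f_h(t) = η(t) t⁻² θ̂(M h / (q² t²))`. -/
def weight (η θ : ℝ → ℝ) (M : ℝ) (q h : ℕ) (t : ℝ) : ℂ :=
  ((η t / t ^ 2 : ℝ) : ℂ) *
    𝓕 (fun x : ℝ => (θ x : ℂ)) (M * (h : ℝ) / ((q : ℝ) ^ 2 * t ^ 2))

/-- The stationary-phase transform
`g̃(t) = e(1/8) 2^{2/3} 1_{t > 0} t^{-2/3} g(2^{1/3} t^{-1/3}) / √6`. -/
def tildeTransform (g : ℝ → ℂ) (t : ℝ) : ℂ :=
  if 0 < t then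
    e (1 / 8) * (((2 : ℝ) ^ (2 / 3 : ℝ) * t ^ (-(2 / 3) : ℝ) / Real.sqrt 6 : ℝ) : ℂ) *
      g ((2 : ℝ) ^ (1 / 3 : ℝ) * t ^ (-(1 / 3) : ℝ))
  else 0

/-- `F_h(t) = √t f̃_h(t)`. -/
def F (η θ : ℝ → ℝ) (M : ℝ) (q h : ℕ) (t : ℝ) : ℂ :=
  (Real.sqrt t : ℂ) * tildeTransform (weight η θ M q h) t

/-- `T(m, h) = (h ρ(m) + h m) / (q N²)`. -/
def T (b L q : ℕ) (N : ℝ) (m h : ℕ) : ℝ :=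
  ((h : ℝ) * (rho b L m : ℝ) + (h : ℝ) * (m : ℝ)) / ((q : ℝ) * N ^ 2)

open Classical in
/-- The quadruples `(a, h, ℓ, n)` with `1 ≤ a ≤ q / s`, `h ≥ 1` in `[hlo, hhi]`, `ℓ` a residue
class modulo `√q` (represented in `[1, √q]`), `n ≥ 1` in `[nlo, nhi]`, `(a ℓ, q) = 1` and
`n ℓ³ ≡ -2 σ a h (mod √q)`. -/
def indexSet (q s : ℕ) (σ : ℤ) (hlo hhi nlo nhi : ℝ) : Finset (ℕ × ℕ × ℕ × ℕ) :=
  (Finset.Icc 1 (q / s) ×ˢ Finset.Icc 1 ⌊hhi⌋₊ ×ˢ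
    Finset.Icc 1 (Nat.sqrt q) ×ˢ Finset.Icc 1 ⌊nhi⌋₊).filter
    fun (a, h, l, n) =>
      hlo ≤ (h : ℝ) ∧ nlo ≤ (n : ℝ) ∧ Nat.Coprime (a * l) q ∧
        (n : ℤ) * (l : ℤ) ^ 3 ≡ -2 * σ * (a : ℤ) * (h : ℤ) [ZMOD (Nat.sqrt q : ℤ)]

/-- The absolute value of the `d`-sum
`∑_{0 ≤ d < s} F_h(N n / (q T)) e_s(σ h d ℓ̄²) e(3 T^{1/3} (N n / (2 q))^{2/3})`,
where `T = T(a + d q / s, h)` and `M = X / N²`, `X = b ^ L`. -/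
def dSum (η θ : ℝ → ℝ) (b L q s : ℕ) (N : ℝ) (σ : ℤ) (a h l n : ℕ) : ℝ :=
  ‖∑ d ∈ Finset.range s,
    F η θ ((b : ℝ) ^ L / N ^ 2) q h
        (N * (n : ℝ) / ((q : ℝ) * T b L q N (a + d * (q / s)) h)) *
      eMod s ((σ : ZMod s) * (h : ZMod s) * (d : ZMod s) * ((l : ZMod s)⁻¹) ^ 2) *
      e (3 * T b L q N (a + d * (q / s)) h ^ (1 / 3 : ℝ) *
        (N * (n : ℝ) / (2 * (q : ℝ))) ^ (2 / 3 : ℝ))‖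

/-- The analytic phase `h^{1/3} n^{2/3} f(k) / (2^{2/3} q f(a)^{2/3}) + ξ f(k)`. -/
def phase (b L q : ℕ) (a h n : ℕ) (ξ : ℝ) (k : ℕ) : ℝ :=
  (h : ℝ) ^ (1 / 3 : ℝ) * (n : ℝ) ^ (2 / 3 : ℝ) * (f b L k : ℝ) /
      ((2 : ℝ) ^ (2 / 3 : ℝ) * (q : ℝ) * (f b L a : ℝ) ^ (2 / 3 : ℝ)) +
    ξ * (f b L k : ℝ)

/-- The first factor `𝒰_U(a, h, ℓ, n; γ, ξ)`, a sum over `0 ≤ m < s / U`. -/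
def factorU (b L q s U : ℕ) (σ : ℤ) (a h l n : ℕ) (γ ξ : ℝ) : ℝ :=
  ‖∑ m ∈ Finset.range (s / U),
    eMod s ((σ : ZMod s) * (h : ZMod s) * (m : ZMod s) * ((l : ZMod s)⁻¹) ^ 2) *
      e (phase b L q a h n ξ (q / s * m) + γ * (rhoTrunc b s m : ℝ))‖

/-- The second factor `𝒱_U(a, h, ℓ, n; γ, ξ)`, a sum over `0 ≤ c < U`. -/
def factorV (b L q s U : ℕ) (σ : ℤ) (a h l n : ℕ) (γ ξ : ℝ) : ℝ :=
  ‖∑ c ∈ Finset.range U,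
    eMod U ((σ : ZMod U) * (h : ZMod U) * (c : ZMod U) * ((l : ZMod U)⁻¹) ^ 2) *
      e (phase b L q a h n ξ (q / U * c) + γ * (rhoTrunc b s (c * (s / U)) : ℝ))‖

/-- The supremum, over `γ ∈ [0, 1]` and `|ξ| ≤ R`, of the sum of `𝒰_U 𝒱_U` over a finite set of
quadruples. -/
def supFactored (b L q s U : ℕ) (σ : ℤ) (I : Finset (ℕ × ℕ × ℕ × ℕ)) (R : ℝ) : ℝ :=
  sSup {y : ℝ | ∃ γ ∈ Set.Icc (0 : ℝ) 1, ∃ ξ : ℝ, |ξ| ≤ R ∧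
    y = ∑ p ∈ I,
      factorU b L q s U σ p.1 p.2.1 p.2.2.1 p.2.2.2 γ ξ *
        factorV b L q s U σ p.1 p.2.1 p.2.2.1 p.2.2.2 γ ξ}

theorem norm_e (x : ℝ) : ‖e x‖ = 1 := by
  rw [e, show 2 * (Real.pi : ℂ) * Complex.I * (x : ℂ) = ((2 * Real.pi * x : ℝ) : ℂ) * Complex.I by
    push_cast; ring]
  exact Complex.norm_exp_ofReal_mul_I _

/-- The supremum is taken over a bounded set. -/
theorem bddAbove_supFactored (b L q s U : ℕ) (σ : ℤ) (I : Finset (ℕ × ℕ × ℕ × ℕ)) (R : ℝ) :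
    BddAbove {y : ℝ | ∃ γ ∈ Set.Icc (0 : ℝ) 1, ∃ ξ : ℝ, |ξ| ≤ R ∧
      y = ∑ p ∈ I,
        factorU b L q s U σ p.1 p.2.1 p.2.2.1 p.2.2.2 γ ξ *
          factorV b L q s U σ p.1 p.2.1 p.2.2.1 p.2.2.2 γ ξ} := by
  refine ⟨∑ _p ∈ I, ((s / U : ℕ) : ℝ) * (U : ℝ), ?_⟩
  rintro y ⟨γ, -, ξ, -, rfl⟩
  refine Finset.sum_le_sum fun p _ => mul_le_mul ?_ ?_ (norm_nonneg _) (Nat.cast_nonneg _)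
  · refine (norm_sum_le _ _).trans (le_of_eq ?_)
    simp [eMod, norm_e]
  · refine (norm_sum_le _ _).trans (le_of_eq ?_)
    simp [eMod, norm_e]

end ReversalSum

end

noncomputable section

namespace ReversalSum

open scoped FourierTransform

/-! Put `x₀ = f(a)`, `q/s = b^t` and `δ = f(b^t d)`. Since `a < b^t`, the digits of `a` and of `b^t
d` occupy disjoint positions, so `f(a + b^t d) = x₀ + δ` and `T = h(x₀ + δ)/(qN²)`. The phase of the
`d`-sum becomes `3K(x₀ + δ)^{1/3}` with `K = phaseCoeff q h n`; its part linear in `δ`, namely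
`Kδ/x₀^{2/3}`, is exactly the phase occurring in `𝒰` and `𝒱`. The weight and the remaining phase
together form an amplitude `G(δ)`. As `(a, q) = 1`, the last digit of `a` is nonzero, so `x₀ ≥ X`;
hence `G` is bounded and has Lipschitz constant `Λ ≪ (1 + rs/q)/X` on the relevant range
(`exists_amplitude_lipschitz`).

Next, `δ = ωρ_s(d) + b^t d` with `ω = bX/q`. In `G` alone the term `b^t d ≤ q` is dropped. The error
is at most `Λq` for each `d`, and with the bound `#I · s ≪ q (qr/M)(qr/N)` of `card_indexSet_le` it
contributes the term `q√r X^{2ε}`. What is left is a function of the integer `v = ρ_s(d) ∈ [0, s)`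
of variation `≪ Λ · bXs/q ≪ X^ε`. Its Fourier coefficients modulo `s` have `ℓ¹` norm `≪ X^ε log s`
(`sum_norm_sum_mul_le`), and frequency `k` merely inserts the twist `e(kρ_s(d)/s)`, that is `γ =
k/s`.

Finally all phases of the twisted linear sum are additive along `d = m + c s/U`, so that sum equals
`𝒰_U 𝒱_U` in absolute value (`norm_sum_linearTerm`). Only `ξ = 0` is needed from the supremum. -/

/-! ### Additive characters and orthogonality -/

theorem e_add (x y : ℝ) : e (x + y) = e x * e y := by
  rw [e, e, e, ← Complex.exp_add]; congr 1; push_cast; ring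

theorem e_zero : e 0 = 1 := by simp [e]

theorem e_natCast_mul (n : ℕ) (x : ℝ) : e (n * x) = e x ^ n := by
  rw [e, e, ← Complex.exp_nat_mul]; congr 1; push_cast; ring

theorem e_intCast (n : ℤ) : e n = 1 := by
  rw [e, Complex.exp_eq_one_iff]; exact ⟨n, by push_cast; ring⟩

theorem e_add_intCast (x : ℝ) (n : ℤ) : e (x + n) = e x := by
  rw [e_add, e_intCast, mul_one]

theorem e_eq_one_iff (x : ℝ) : e x = 1 ↔ ∃ n : ℤ, x = n := by
  constructor
  · intro h
    rw [e, Complex.exp_eq_one_iff] at h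
    obtain ⟨n, hn⟩ := h
    refine ⟨n, ?_⟩
    have h2 : (2 * (Real.pi : ℂ) * Complex.I) ≠ 0 := Complex.two_pi_I_ne_zero
    have : (2 * (Real.pi : ℂ) * Complex.I) * (x : ℂ) = (2 * (Real.pi : ℂ) * Complex.I) * (n : ℂ) := by
      rw [hn]; ring
    exact_mod_cast mul_left_cancel₀ h2 this
  · rintro ⟨n, rfl⟩; exact e_intCast n

theorem norm_e_sub_one (x : ℝ) : ‖e x - 1‖ = 2 * |Real.sin (Real.pi * x)| := by
  have := Complex.norm_exp_I_mul_ofReal_sub_one (2 * Real.pi * x)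
  rw [show Real.pi * x = 2 * Real.pi * x / 2 by ring]
  rw [Real.norm_eq_abs, abs_mul, abs_two] at this
  rw [← this, e]
  congr 3; push_cast; ring

theorem norm_e_sub_e_le (x y : ℝ) : ‖e x - e y‖ ≤ 2 * Real.pi * |x - y| := by
  have h : e x - e y = e y * (e (x - y) - 1) := by
    rw [mul_sub, ← e_add, mul_one]; congr 2; ring
  rw [h, norm_mul, norm_e, one_mul, norm_e_sub_one]
  have h1 : |Real.sin (Real.pi * (x - y))| ≤ |Real.pi * (x - y)| := Real.abs_sin_le_abs
  rw [abs_mul, abs_of_pos Real.pi_pos] at h1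
  linarith

/-- Orthogonality of the additive characters modulo `s`. -/
theorem sum_e_div_eq_ite {s : ℕ} (hs : 0 < s) {v w : ℕ} (hv : v < s) (hw : w < s) :
    ∑ k ∈ Finset.range s, e (-(k * w / s : ℝ)) * e (k * v / s : ℝ) =
      if w = v then (s : ℂ) else 0 := by
  have hs' : (s : ℝ) ≠ 0 := by positivity
  have h : ∀ k : ℕ, e (-(k * w / s : ℝ)) * e (k * v / s : ℝ) =
      e (((v : ℝ) - w) / s) ^ k := by
    intro k
    rw [← e_add, ← e_natCast_mul]; congr 1; ring
  simp only [h]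
  split_ifs with hwv
  · subst hwv
    simp [e_zero]
  · have h1 : e (((v : ℝ) - w) / s) ≠ 1 := by
      intro h1
      obtain ⟨n, hn⟩ := (e_eq_one_iff _).1 h1
      rw [div_eq_iff hs'] at hn
      have hn' : (v : ℤ) - w = n * s := by exact_mod_cast hn
      have hd : (s : ℤ) ∣ (v : ℤ) - w := ⟨n, by rw [hn', mul_comm]⟩
      have := Int.eq_zero_of_abs_lt_dvd hd (by rw [abs_lt]; constructor <;> omega)
      omega
    have h2 : e (((v : ℝ) - w) / s) ^ s = 1 := by
      rw [← e_natCast_mul, mul_div_cancel₀ _ hs']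
      exact_mod_cast e_intCast ((v : ℤ) - w)
    have := mul_geom_sum (e (((v : ℝ) - w) / s)) s
    rw [h2, sub_self] at this
    exact (mul_eq_zero.1 this).resolve_left (sub_ne_zero.2 h1)

/-! ### Fourier expansion of functions of bounded variation modulo `s` -/

theorem sum_mul_pow_by_parts (G : ℕ → ℂ) (z : ℂ) (n : ℕ) :
    (z - 1) * ∑ v ∈ Finset.range (n + 1), G v * z ^ v =
      G n * z ^ (n + 1) - G 0 - ∑ v ∈ Finset.range n, (G (v + 1) - G v) * z ^ (v + 1) := by
  induction n with
  | zero => simp; ring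
  | succ n ih => rw [Finset.sum_range_succ, mul_add, ih, Finset.sum_range_succ _ n]; ring

/-- The `k`-th Fourier coefficient of `G` on `{0, …, s - 1}`. -/
def fourierCoefficient (s : ℕ) (G : ℕ → ℂ) (k : ℕ) : ℂ :=
  (s : ℂ)⁻¹ * ∑ w ∈ Finset.range s, G w * e (-(k * w / s : ℝ))

theorem eq_sum_fourierCoefficient {s : ℕ} (G : ℕ → ℂ) {v : ℕ} (hv : v < s) :
    G v = ∑ k ∈ Finset.range s, fourierCoefficient s G k * e (k * v / s : ℝ) := by
  have hs : 0 < s := by omega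
  have hs' : (s : ℂ) ≠ 0 := by exact_mod_cast hs.ne'
  simp only [fourierCoefficient, mul_assoc, Finset.sum_mul]
  rw [← Finset.mul_sum, Finset.sum_comm]
  simp only [← Finset.mul_sum]
  rw [Finset.sum_congr rfl fun w hw => by
    rw [sum_e_div_eq_ite hs hv (Finset.mem_range.1 hw)]]
  simp [hv]
  field_simp

/-- A weight dominating the Fourier coefficients of functions of bounded variation. -/
def bvWeight (s k : ℕ) : ℝ := if k = 0 then 1 else 1 / (k : ℝ) + 1 / ((s : ℝ) - k)

/-- Jordan's inequality gives `|sin(πk/s)| ≥ 2 min(k, s - k)/s`; the two cases use one summand each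
of `bvWeight`. -/
theorem le_norm_e_sub_one {s k : ℕ} (hk : 0 < k) (hks : k < s) :
    1 ≤ (s : ℝ) * ‖e (-(k / s : ℝ)) - 1‖ * bvWeight s k := by
  have hs : (0 : ℝ) < s := by exact_mod_cast (by omega : 0 < s)
  have hk' : (0 : ℝ) < k := by exact_mod_cast hk
  have hks' : (k : ℝ) < s := by exact_mod_cast hks
  rw [norm_e_sub_one, bvWeight, if_neg hk.ne', mul_neg, Real.sin_neg, abs_neg]
  have hd : (0 : ℝ) < s - k := by linarith
  have key : ∀ x : ℝ, 0 < x → x ≤ s / 2 → 2 * x / s ≤ Real.sin (Real.pi * (x / s)) := by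
    intro x hx hx2
    have h := Real.mul_le_sin (x := Real.pi * (x / s)) (by positivity) (by
      rw [mul_div_assoc', div_le_div_iff₀ hs two_pos]
      nlinarith [Real.pi_pos])
    refine le_trans (le_of_eq ?_) h
    field_simp
  rcases le_total (k : ℝ) (s / 2) with h | h
  · have h1 := key k hk' h
    have h2 : 2 * (k : ℝ) / s ≤ |Real.sin (Real.pi * (k / s))| := h1.trans (le_abs_self _)
    calc (1 : ℝ) ≤ s * (2 * (2 * k / s)) * (1 / k) := by
          rw [show (s : ℝ) * (2 * (2 * k / s)) * (1 / k) = 4 by field_simp; norm_num]; norm_num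
      _ ≤ _ := by gcongr; exact le_add_of_nonneg_right (by positivity)
  · have h1 := key (s - k) hd (by linarith)
    rw [show Real.pi * (((s : ℝ) - k) / s) = Real.pi - Real.pi * (k / s) by field_simp,
      Real.sin_pi_sub] at h1
    have h2 : 2 * ((s : ℝ) - k) / s ≤ |Real.sin (Real.pi * (k / s))| := h1.trans (le_abs_self _)
    calc (1 : ℝ) ≤ s * (2 * (2 * (s - k) / s)) * (1 / (s - k)) := by
          rw [show (s : ℝ) * (2 * (2 * (s - k) / s)) * (1 / (s - k)) = 4 by
            field_simp; norm_num]
          norm_num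
      _ ≤ _ := by gcongr; exact le_add_of_nonneg_left (by positivity)

theorem bvWeight_nonneg {s k : ℕ} (hks : k < s) : 0 ≤ bvWeight s k := by
  have : (k : ℝ) < s := by exact_mod_cast hks
  have : (0 : ℝ) < s - k := by linarith
  unfold bvWeight; split_ifs <;> positivity

/-- For `k ≠ 0`, summation by parts against the geometric sequence `z^w`, `z = e(-k/s)`: the two
boundary terms cost `2B`, the differences cost `V`, and the division by `s‖z - 1‖` is absorbed by
`bvWeight`. -/
theorem norm_fourierCoefficient_le {s : ℕ} {G : ℕ → ℂ} {B V : ℝ}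
    (hB : ∀ v < s, ‖G v‖ ≤ B) (hV : ∀ v, v + 1 < s → ‖G (v + 1) - G v‖ ≤ V / s) (hV0 : 0 ≤ V)
    {k : ℕ} (hk : k < s) :
    ‖fourierCoefficient s G k‖ ≤ (2 * B + V) * bvWeight s k := by
  have hs : (0 : ℝ) < s := by exact_mod_cast (by omega : 0 < s)
  have hB0 : 0 ≤ B := (norm_nonneg _).trans (hB k hk)
  rw [fourierCoefficient, norm_mul, norm_inv, Complex.norm_natCast]
  rcases Nat.eq_zero_or_pos k with rfl | hk0
  · have h : ‖∑ w ∈ Finset.range s, G w * e (-(((0 : ℕ) : ℝ) * w / s : ℝ))‖ ≤ s * B := by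
      refine (norm_sum_le _ _).trans ?_
      refine (Finset.sum_le_sum (g := fun _ => B) fun w hw => ?_).trans (by simp)
      rw [norm_mul, norm_e, mul_one]; exact hB w (Finset.mem_range.1 hw)
    rw [bvWeight, if_pos rfl, mul_one, inv_mul_le_iff₀ hs]
    nlinarith
  · obtain ⟨n, rfl⟩ : ∃ n, s = n + 1 := ⟨s - 1, by omega⟩
    set z := e (-(k / (n + 1 : ℕ) : ℝ)) with hz
    have h1 : ∀ w : ℕ, e (-(k * w / (n + 1 : ℕ) : ℝ)) = z ^ w := by
      intro w; rw [hz, ← e_natCast_mul]; congr 1; ring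
    simp only [h1]
    have hzn : ‖z‖ = 1 := norm_e _
    have h2 := sum_mul_pow_by_parts G z n
    have h3 : ‖(z - 1) * ∑ v ∈ Finset.range (n + 1), G v * z ^ v‖ ≤ 2 * B + V := by
      rw [h2]
      have e1 : ‖G n * z ^ (n + 1)‖ ≤ B := by
        rw [norm_mul, norm_pow, hzn, one_pow, mul_one]; exact hB n (by omega)
      have e2 : ‖G 0‖ ≤ B := hB 0 (by omega)
      have e3 : ‖∑ v ∈ Finset.range n, (G (v + 1) - G v) * z ^ (v + 1)‖ ≤ V := by
        refine (norm_sum_le _ _).trans ?_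
        refine (Finset.sum_le_sum (g := fun _ => V / (n + 1 : ℕ)) fun w hw => ?_).trans ?_
        · rw [norm_mul, norm_pow, hzn, one_pow, mul_one]
          exact hV w (by have := Finset.mem_range.1 hw; omega)
        · simp only [Finset.sum_const, Finset.card_range, nsmul_eq_mul]
          rw [mul_div_assoc', div_le_iff₀ hs]
          push_cast; nlinarith
      exact (norm_sub_le _ _).trans (by linarith [norm_sub_le (G n * z ^ (n + 1)) (G 0)])
    rw [norm_mul] at h3
    have h4 := le_norm_e_sub_one hk0 hk
    rw [← hz] at h4
    rw [inv_mul_le_iff₀ hs]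
    set S := ‖∑ v ∈ Finset.range (n + 1), G v * z ^ v‖
    have hw := bvWeight_nonneg hk
    calc S ≤ S * ((n + 1 : ℕ) * ‖z - 1‖ * bvWeight (n + 1) k) :=
          le_mul_of_one_le_right (norm_nonneg _) h4
      _ = (n + 1 : ℕ) * ((‖z - 1‖ * S) * bvWeight (n + 1) k) := by ring
      _ ≤ _ := by gcongr

theorem sum_bvWeight_le {s : ℕ} (hs : 0 < s) :
    ∑ k ∈ Finset.range s, bvWeight s k ≤ 3 + 2 * Real.log s := by
  obtain ⟨n, rfl⟩ : ∃ n, s = n + 1 := ⟨s - 1, by omega⟩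
  rw [Finset.sum_range_succ']
  have h0 : bvWeight (n + 1) 0 = 1 := by simp [bvWeight]
  have h1 : ∑ k ∈ Finset.range n, bvWeight (n + 1) (k + 1) =
      ∑ k ∈ Finset.range n, 1 / ((k : ℝ) + 1) + ∑ k ∈ Finset.range n, 1 / ((k : ℝ) + 1) := by
    -- Reflection turns the sum of `1/(s - k)` into a second harmonic sum.
    nth_rewrite 3 [← Finset.sum_range_reflect]
    rw [← Finset.sum_add_distrib]
    refine Finset.sum_congr rfl fun k hk => ?_
    have hk := Finset.mem_range.1 hk
    rw [bvWeight, if_neg (by omega), Nat.sub_sub, Nat.cast_sub (by omega)]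
    push_cast
    congr 2; ring
  have h2 : ∑ k ∈ Finset.range n, 1 / ((k : ℝ) + 1) ≤ 1 + Real.log n := by
    have := harmonic_le_one_add_log n
    simpa [harmonic] using this
  have h3 : Real.log n ≤ Real.log ((n + 1 : ℕ) : ℝ) := by
    rcases Nat.eq_zero_or_pos n with rfl | hn
    · simp
    · exact Real.log_le_log (by exact_mod_cast hn) (by push_cast; linarith)
  rw [h0, h1]; linarith

/-- Separation of variables: a function of bounded variation of an integer variable is removed
at the cost of a logarithm, uniformly over a family of sums. -/
theorem sum_norm_sum_mul_le {ι : Type*} {I : Finset ι} {s : ℕ} (hs : 0 < s)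
    {G : ι → ℕ → ℂ} {A : ι → ℕ → ℂ} {R : ℕ → ℕ} {B V Y : ℝ} (hR : ∀ d < s, R d < s)
    (hB0 : 0 ≤ B) (hV0 : 0 ≤ V) (hY0 : 0 ≤ Y)
    (hB : ∀ p ∈ I, ∀ v < s, ‖G p v‖ ≤ B)
    (hV : ∀ p ∈ I, ∀ v, v + 1 < s → ‖G p (v + 1) - G p v‖ ≤ V / s)
    (hY : ∀ k < s, ∑ p ∈ I, ‖∑ d ∈ Finset.range s, A p d * e (k / s * R d : ℝ)‖ ≤ Y) :
    ∑ p ∈ I, ‖∑ d ∈ Finset.range s, G p (R d) * A p d‖ ≤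
      (2 * B + V) * (3 + 2 * Real.log s) * Y := by
  have h1 : ∀ p ∈ I, ‖∑ d ∈ Finset.range s, G p (R d) * A p d‖ ≤
      ∑ k ∈ Finset.range s, (2 * B + V) * bvWeight s k *
        ‖∑ d ∈ Finset.range s, A p d * e (k / s * R d : ℝ)‖ := by
    intro p hp
    have h2 : ∑ d ∈ Finset.range s, G p (R d) * A p d =
        ∑ k ∈ Finset.range s, fourierCoefficient s (G p) k *
          ∑ d ∈ Finset.range s, A p d * e (k / s * R d : ℝ) := by
      simp only [Finset.mul_sum]
      rw [Finset.sum_comm]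
      refine Finset.sum_congr rfl fun d hd => ?_
      rw [eq_sum_fourierCoefficient (G p) (hR d (Finset.mem_range.1 hd)), Finset.sum_mul]
      refine Finset.sum_congr rfl fun k _ => ?_
      rw [show (k / s * R d : ℝ) = k * R d / s by ring]; ring
    rw [h2]
    refine (norm_sum_le _ _).trans (Finset.sum_le_sum fun k hk => ?_)
    rw [norm_mul]
    gcongr
    exact norm_fourierCoefficient_le (hB p hp) (hV p hp) hV0 (Finset.mem_range.1 hk)
  refine (Finset.sum_le_sum h1).trans ?_
  rw [Finset.sum_comm]
  calc _ ≤ ∑ k ∈ Finset.range s, (2 * B + V) * bvWeight s k * Y := by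
        refine Finset.sum_le_sum fun k hk => ?_
        rw [← Finset.mul_sum]
        have := bvWeight_nonneg (Finset.mem_range.1 hk)
        gcongr
        exact hY k (Finset.mem_range.1 hk)
    _ = (2 * B + V) * (∑ k ∈ Finset.range s, bvWeight s k) * Y := by
        rw [Finset.mul_sum, Finset.sum_mul]
    _ ≤ _ := by gcongr; exact sum_bvWeight_le hs

/-! ### Digits and the reversal functions -/

theorem digit_eq_zero_of_lt {b j n : ℕ} (hn : n < b ^ j) : digit b j n = 0 := by
  rw [digit, Nat.div_eq_of_lt hn, Nat.zero_mod]

theorem digit_zero_right (b j : ℕ) : digit b j 0 = 0 := by simp [digit]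

theorem digit_lt {b : ℕ} (hb : 2 ≤ b) (j n : ℕ) : digit b j n < b := Nat.mod_lt _ (by omega)

/-- Appending the base-`b` expansion of `d` to that of `a < b ^ i` concatenates the digits. -/
theorem digit_add_pow_mul {b : ℕ} (hb : 2 ≤ b) {i a : ℕ} (ha : a < b ^ i) (d j : ℕ) :
    digit b j (a + b ^ i * d) = if j < i then digit b j a else digit b (j - i) d := by
  have hb0 : 0 < b := by omega
  split_ifs with hj
  · obtain ⟨k, rfl⟩ : ∃ k, i = j + (k + 1) := ⟨i - j - 1, by omega⟩
    rw [digit, digit, pow_add, mul_assoc, Nat.add_mul_div_left _ _ (pow_pos hb0 _), pow_succ',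
      mul_assoc, Nat.add_mul_mod_self_left]
  · obtain ⟨k, rfl⟩ : ∃ k, j = i + k := ⟨j - i, by omega⟩
    rw [digit, digit, pow_add, ← Nat.div_div_eq_div_mul,
      Nat.add_mul_div_left _ _ (pow_pos hb0 _), Nat.div_eq_of_lt ha, zero_add,
      Nat.add_sub_cancel_left]

theorem digit_add {b : ℕ} (hb : 2 ≤ b) {i a : ℕ} (ha : a < b ^ i) (d j : ℕ) :
    digit b j (a + b ^ i * d) = digit b j a + digit b j (b ^ i * d) := by
  have h0 := digit_add_pow_mul hb (i := i) (a := 0) (pow_pos (by omega) _) d j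
  rw [zero_add] at h0
  rw [digit_add_pow_mul hb ha, h0]
  split_ifs with hj
  · rw [digit_zero_right, add_zero]
  · rw [digit_eq_zero_of_lt (ha.trans_le (Nat.pow_le_pow_right (by omega) (by omega))), zero_add]

theorem rho_add {b : ℕ} (hb : 2 ≤ b) (L : ℕ) {i a : ℕ} (ha : a < b ^ i) (d : ℕ) :
    rho b L (a + b ^ i * d) = rho b L a + rho b L (b ^ i * d) := by
  simp only [rho, ← Finset.sum_add_distrib, ← add_mul, digit_add hb ha]

/-- No carries occur when the digit blocks are disjoint. This additivity isolates the increment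
`f(b^i d)` and later makes the linear phase factor. -/
theorem f_add {b : ℕ} (hb : 2 ≤ b) (L : ℕ) {i a : ℕ} (ha : a < b ^ i) (d : ℕ) :
    f b L (a + b ^ i * d) = f b L a + f b L (b ^ i * d) := by
  simp only [f, rho_add hb L ha]; omega

theorem rhoTrunc_add {b : ℕ} (hb : 2 ≤ b) (s : ℕ) {i a : ℕ} (ha : a < b ^ i) (d : ℕ) :
    rhoTrunc b s (a + b ^ i * d) = rhoTrunc b s a + rhoTrunc b s (b ^ i * d) := by
  simp only [rhoTrunc, ← Finset.sum_add_distrib, ← add_mul, digit_add hb ha]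

theorem rhoTrunc_lt {b : ℕ} (hb : 2 ≤ b) (t n : ℕ) : rhoTrunc b (b ^ t) n < b ^ t := by
  rw [rhoTrunc, Nat.log_pow (by omega)]
  induction t with
  | zero => simp
  | succ t ih =>
    rw [Finset.sum_range_succ]
    have h : ∑ j ∈ Finset.range t, digit b j n * b ^ (t + 1 - 1 - j) =
        (∑ j ∈ Finset.range t, digit b j n * b ^ (t - 1 - j)) * b := by
      rw [Finset.sum_mul]
      refine Finset.sum_congr rfl fun j hj => ?_
      have := Finset.mem_range.1 hj
      rw [mul_assoc, ← pow_succ]; congr 2; omega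
    rw [h, pow_succ]
    have := digit_lt hb t n
    simp only [Nat.add_sub_cancel, Nat.sub_self, pow_zero, mul_one]
    nlinarith

/-- Only the positions `i ≤ j < i + t` carry nonzero digits, and there the weight `b^{L-j}` is the
weight in `ρ_{b^t}` times a fixed power of `b`. -/
theorem rho_pow_mul {b : ℕ} (hb : 2 ≤ b) {L i t : ℕ} (hit : i + t ≤ L + 1) {d : ℕ}
    (hd : d < b ^ t) :
    rho b L (b ^ i * d) = b ^ (L + 1 - (i + t)) * rhoTrunc b (b ^ t) d := by
  have h0 := digit_add_pow_mul hb (i := i) (a := 0) (pow_pos (by omega) _) d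
  simp only [zero_add] at h0
  rw [rho, rhoTrunc, Nat.log_pow (by omega), show L + 1 = i + (t + (L + 1 - (i + t))) by omega,
    Finset.sum_range_add, Finset.sum_range_add, Finset.sum_eq_zero, Finset.mul_sum, zero_add,
    Finset.sum_eq_zero (s := Finset.range (L + 1 - (i + t))), add_zero]
  · refine Finset.sum_congr rfl fun j hj => ?_
    have := Finset.mem_range.1 hj
    rw [h0, if_neg (by omega), Nat.add_sub_cancel_left, mul_left_comm, ← pow_add]
    congr 2; omega
  · intro j _
    rw [h0, if_neg (by omega), digit_eq_zero_of_lt, zero_mul]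
    exact hd.trans_le (Nat.pow_le_pow_right (by omega) (by omega))
  · intro j hj
    have := Finset.mem_range.1 hj
    rw [h0, if_pos (by omega), digit_zero_right, zero_mul]

/-- Reversal makes the nonzero last digit the leading one. This keeps `f(a)` away from the
singularity of the cube root. -/
theorem pow_le_f {b L a : ℕ} (ha : a % b ≠ 0) : b ^ L ≤ f b L a := by
  have h : digit b 0 a * b ^ (L - 0) ≤ rho b L a :=
    Finset.single_le_sum (f := fun j => digit b j a * b ^ (L - j)) (fun _ _ => Nat.zero_le _)
      (Finset.mem_range.2 (by omega))
  have h1 : 1 ≤ digit b 0 a := by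
    rw [digit, pow_zero, Nat.div_one]; omega
  rw [Nat.sub_zero] at h
  rw [f]; nlinarith

/-! ### Factorisation of the linear sum -/

theorem sum_range_mul_eq {M : Type*} [AddCommMonoid M] (a c : ℕ) (g : ℕ → M) :
    ∑ d ∈ Finset.range (a * c), g d =
      ∑ m ∈ Finset.range a, ∑ k ∈ Finset.range c, g (m + a * k) := by
  rw [Finset.sum_comm]
  induction c with
  | zero => simp
  | succ c ih =>
    rw [Finset.sum_range_succ, ← ih, mul_add, mul_one, Finset.sum_range_add]
    simp only [add_comm]

theorem eMod_intCast {s : ℕ} (hs : 0 < s) (z : ℤ) : eMod s (z : ZMod s) = e ((z : ℝ) / s) := by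
  have : NeZero s := ⟨hs.ne'⟩
  have h : (((z : ZMod s).val : ℤ) : ℤ) = z % s := ZMod.val_intCast z
  have h2 : z = z % s + s * (z / s) := (Int.emod_add_mul_ediv z s).symm
  have hs' : (s : ℝ) ≠ 0 := by positivity
  have h3 : (z : ℝ) / s = ((z : ZMod s).val : ℝ) / s + (z / (s : ℤ) : ℤ) := by
    rw [div_add' _ _ _ hs']
    congr 1
    have : (((z : ZMod s).val : ℤ) : ℝ) = ((z % s : ℤ) : ℝ) := by rw [h]
    push_cast at this
    rw [this]
    exact_mod_cast (by rw [mul_comm (z / (s : ℤ))]; exact h2)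
  rw [h3, e_add_intCast, eMod]

/-- A Bézout coefficient inverts `l` modulo `s` and modulo each divisor at once, so the characters
modulo `s` and `U` can be compared through one integer. -/
theorem exists_inverse {s l : ℕ} (hl : Nat.Coprime l s) :
    ∃ j : ℤ, ∀ U : ℕ, U ∣ s → ((l : ZMod U)⁻¹) = (j : ZMod U) := by
  refine ⟨Nat.gcdA l s, fun U hU => ?_⟩
  have hlU : Nat.Coprime l U := hl.coprime_dvd_right hU
  have h := Nat.gcd_eq_gcd_ab l s
  rw [hl] at h
  have h2 : ((l : ZMod U)) * ((Nat.gcdA l s : ℤ) : ZMod U) = 1 := by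
    have h3 := congrArg (fun z : ℤ => (z : ZMod U)) h
    have h4 : ((s : ℕ) : ZMod U) = 0 := (ZMod.natCast_eq_zero_iff _ _).2 hU
    push_cast at h3
    rw [h4, zero_mul, add_zero] at h3
    exact h3.symm
  have h5 := ZMod.coe_mul_inv_eq_one l hlU
  calc (l : ZMod U)⁻¹ = (l : ZMod U)⁻¹ * (l * ((Nat.gcdA l s : ℤ) : ZMod U)) := by rw [h2, mul_one]
    _ = (l * (l : ZMod U)⁻¹) * ((Nat.gcdA l s : ℤ) : ZMod U) := by ring
    _ = _ := by rw [h5, one_mul]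

/-- The arithmetic and linear analytic phases of the `d`-sum. -/
def linearTerm (b L q s : ℕ) (σ : ℤ) (a h l n d : ℕ) : ℂ :=
  eMod s ((σ : ZMod s) * (h : ZMod s) * (d : ZMod s) * ((l : ZMod s)⁻¹) ^ 2) *
    e (phase b L q a h n 0 (d * (q / s)))

/-- The twisted linear `d`-sum factors along `d = m + c s / U`. -/
theorem norm_sum_linearTerm {b : ℕ} (hb : 2 ≤ b) (L : ℕ) {i k t : ℕ} (σ : ℤ) (a h l n : ℕ)
    (hl : Nat.Coprime l (b ^ (i + k))) (γ : ℝ) :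
    ‖∑ d ∈ Finset.range (b ^ (i + k)), linearTerm b L (b ^ (i + k + t)) (b ^ (i + k)) σ a h l n d *
        e (γ * (rhoTrunc b (b ^ (i + k)) d : ℝ))‖ =
      factorU b L (b ^ (i + k + t)) (b ^ (i + k)) (b ^ k) σ a h l n γ 0 *
        factorV b L (b ^ (i + k + t)) (b ^ (i + k)) (b ^ k) σ a h l n γ 0 := by
  have hb0 : 0 < b := by omega
  obtain ⟨j, hj⟩ := exists_inverse hl
  have hs : b ^ (i + k) = b ^ i * b ^ k := pow_add _ _ _
  have hdiv1 : b ^ (i + k) / b ^ k = b ^ i := by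
    rw [hs, Nat.mul_div_cancel _ (pow_pos hb0 _)]
  have hdiv2 : b ^ (i + k + t) / b ^ (i + k) = b ^ t := by
    rw [pow_add _ (i + k), Nat.mul_div_cancel_left _ (pow_pos hb0 _)]
  have hdiv3 : b ^ (i + k + t) / b ^ k = b ^ (i + t) := by
    rw [show i + k + t = i + t + k by ring, pow_add _ (i + t),
      Nat.mul_div_cancel _ (pow_pos hb0 _)]
  rw [factorU, factorV, ← norm_mul, hdiv1, hdiv2, hdiv3, Finset.sum_mul_sum]
  nth_rewrite 1 [hs]
  rw [sum_range_mul_eq]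
  congr 1
  refine Finset.sum_congr rfl fun m hm => Finset.sum_congr rfl fun c _ => ?_
  have hm := Finset.mem_range.1 hm
  rw [linearTerm, hdiv2, hj _ dvd_rfl, hj _ (pow_dvd_pow _ (by omega : k ≤ i + k))]
  have hf : f b L ((m + b ^ i * c) * b ^ t) = f b L (b ^ t * m) + f b L (b ^ (i + t) * c) := by
    rw [← f_add hb L]
    · congr 1; ring
    · rw [add_comm i, pow_add]; exact Nat.mul_lt_mul_of_pos_left hm (pow_pos hb0 _)
  have hr := rhoTrunc_add hb (b ^ (i + k)) hm c
  have e1 : eMod (b ^ (i + k)) ((σ : ZMod (b ^ (i + k))) * (h : ZMod (b ^ (i + k))) *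
      ((m + b ^ i * c : ℕ) : ZMod (b ^ (i + k))) * (j : ZMod (b ^ (i + k))) ^ 2) =
      e ((σ * h * (m + b ^ i * c : ℕ) * j ^ 2 : ℤ) / (b ^ (i + k) : ℕ)) := by
    rw [← eMod_intCast (pow_pos hb0 _)]; push_cast; rfl
  have e2 : eMod (b ^ (i + k)) ((σ : ZMod (b ^ (i + k))) * (h : ZMod (b ^ (i + k))) *
      (m : ZMod (b ^ (i + k))) * (j : ZMod (b ^ (i + k))) ^ 2) =
      e ((σ * h * m * j ^ 2 : ℤ) / (b ^ (i + k) : ℕ)) := by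
    rw [← eMod_intCast (pow_pos hb0 _)]; push_cast; rfl
  have e3 : eMod (b ^ k) ((σ : ZMod (b ^ k)) * (h : ZMod (b ^ k)) *
      (c : ZMod (b ^ k)) * (j : ZMod (b ^ k)) ^ 2) =
      e ((σ * h * c * j ^ 2 : ℤ) / (b ^ k : ℕ)) := by
    rw [← eMod_intCast (pow_pos hb0 _)]; push_cast; rfl
  -- Both sides are now single exponentials. The contribution of `b^i c` over the modulus `b^{i+k}`
  -- is that of `c` over `b^k`, which is why `𝒱` has modulus `U`.
  rw [e1, e2, e3, ← e_add, ← e_add, ← e_add, ← e_add, ← e_add]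
  congr 1
  rw [hr]
  simp only [phase, hf, mul_comm c]
  have hbr : (b : ℝ) ≠ 0 := by positivity
  push_cast
  rw [pow_add]
  field_simp
  ring

/-! ### Size and variation of the weight and of the nonlinear phase -/

/-- The Fourier transform of a test function is bounded, and so is `y θ̂'(y)`. -/
theorem exists_fourier_bound {θ : ℝ → ℝ} (hθ : ContDiff ℝ (⊤ : ℕ∞) θ)
    (hs : HasCompactSupport θ) :
    ∃ C : ℝ, 0 < C ∧ ∀ y : ℝ, DifferentiableAt ℝ (𝓕 (fun x : ℝ => (θ x : ℂ))) y ∧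
      ‖𝓕 (fun x : ℝ => (θ x : ℂ)) y‖ ≤ C ∧
      |y| * ‖deriv (𝓕 (fun x : ℝ => (θ x : ℂ))) y‖ ≤ C := by
  have h1 : HasCompactSupport (fun x : ℝ => (θ x : ℂ)) :=
    hs.comp_left (g := fun x : ℝ => (x : ℂ)) (by simp)
  have h2 : ContDiff ℝ (⊤ : ℕ∞) (fun x : ℝ => (θ x : ℂ)) :=
    Complex.ofRealCLM.contDiff.comp hθ
  set φ : SchwartzMap ℝ ℂ := h1.toSchwartzMap h2
  have h3 : (𝓕 (fun x : ℝ => (θ x : ℂ))) = ((𝓕 φ : SchwartzMap ℝ ℂ) : ℝ → ℂ) := by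
    rw [SchwartzMap.fourier_coe]; rfl
  rw [h3]
  obtain ⟨C₀, hC₀, h₀⟩ := (𝓕 φ : SchwartzMap ℝ ℂ).decay 0 0
  obtain ⟨C₁, hC₁, h₁⟩ := (𝓕 φ : SchwartzMap ℝ ℂ).decay 1 1
  refine ⟨C₀ + C₁, by positivity, fun y => ⟨(𝓕 φ : SchwartzMap ℝ ℂ).differentiableAt, ?_, ?_⟩⟩
  · have := h₀ y
    rw [pow_zero, one_mul, norm_iteratedFDeriv_zero] at this
    linarith
  · have := h₁ y
    rw [pow_one, norm_iteratedFDeriv_eq_norm_iteratedDeriv, iteratedDeriv_one,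
      Real.norm_eq_abs] at this
    linarith

/-- The weight function in the variable `u = (2 / t)^{1/3}`, up to a constant. -/
def profile (η : ℝ → ℝ) (Θ : ℝ → ℂ) (κ u : ℝ) : ℂ :=
  ((u ^ (-(3 / 2) : ℝ) * η u : ℝ) : ℂ) * Θ (κ / u ^ 2)

/-- Uniformity in `κ` is the point. It holds because `u · d/du` of `Θ(κ/u²)` is `-2yΘ'(y)` at `y =
κ/u²`, and `yΘ'(y)` is bounded, while `η` confines `u` to `[1/4, 4]`. -/
theorem exists_profile_bound {η : ℝ → ℝ} (hη : ContDiff ℝ (⊤ : ℕ∞) η)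
    (hsupp : Function.support η ⊆ Set.Icc (1 / 4) 4) {Θ : ℝ → ℂ} {C : ℝ}
    (hΘ : ∀ y, DifferentiableAt ℝ Θ y ∧ ‖Θ y‖ ≤ C ∧ |y| * ‖deriv Θ y‖ ≤ C) :
    ∃ D : ℝ, 0 < D ∧ ∀ κ u : ℝ, 0 < u → ‖profile η Θ κ u‖ ≤ D ∧
      ∃ w : ℂ, HasDerivAt (profile η Θ κ) w u ∧ u * ‖w‖ ≤ D := by
  have htsupp : tsupport η ⊆ Set.Icc (1 / 4) 4 := closure_minimal hsupp isClosed_Icc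
  have hcs : HasCompactSupport η := HasCompactSupport.of_support_subset_isCompact isCompact_Icc hsupp
  obtain ⟨B₀, hB₀⟩ := hcs.exists_bound_of_continuous hη.continuous
  obtain ⟨B₁, hB₁⟩ := hcs.deriv.exists_bound_of_continuous (hη.continuous_deriv (by simp))
  have hB₀' : 0 ≤ B₀ := (norm_nonneg _).trans (hB₀ 0)
  have hB₁' : 0 ≤ B₁ := (norm_nonneg _).trans (hB₁ 0)
  have hC : 0 ≤ C := (norm_nonneg _).trans (hΘ 0).2.1
  have hp : ∀ u : ℝ, u ∈ Set.Icc (1 / 4 : ℝ) 4 → u ^ (-(3 / 2) : ℝ) ≤ 8 := by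
    intro u hu
    refine (Real.rpow_le_rpow_of_nonpos (by norm_num) hu.1 (by norm_num)).trans (le_of_eq ?_)
    rw [show (1 / 4 : ℝ) = 2 ^ (-2 : ℝ) by
      rw [Real.rpow_neg (by norm_num)]; norm_num, ← Real.rpow_mul (by norm_num)]
    norm_num
  have hg : ∀ u : ℝ, 0 < u → |u ^ (-(3 / 2) : ℝ) * η u| ≤ 8 * B₀ := by
    intro u hu
    by_cases h : u ∈ Set.Icc (1 / 4 : ℝ) 4
    · rw [abs_mul, abs_of_nonneg (by positivity)]
      exact mul_le_mul (hp u h) (hB₀ u) (abs_nonneg _) (by norm_num)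
    · rw [Function.notMem_support.1 fun h' => h (hsupp h'), mul_zero, abs_zero]; positivity
  have hg' : ∀ u : ℝ, 0 < u → |u ^ (-(3 / 2) : ℝ) * (u * deriv η u)| ≤ 32 * B₁ := by
    intro u hu
    by_cases h : u ∈ Set.Icc (1 / 4 : ℝ) 4
    · rw [abs_mul, abs_mul, abs_of_nonneg (by positivity : 0 ≤ u ^ (-(3 / 2) : ℝ)),
        abs_of_pos hu]
      calc u ^ (-(3 / 2) : ℝ) * (u * |deriv η u|) ≤ 8 * (4 * B₁) := by
            have := hB₁ u
            rw [Real.norm_eq_abs] at this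
            exact mul_le_mul (hp u h) (mul_le_mul h.2 this (abs_nonneg _) (by norm_num))
              (by positivity) (by norm_num)
        _ = _ := by ring
    · rw [Function.notMem_support.1 fun h' => h (htsupp (support_deriv_subset h')), mul_zero,
        mul_zero, abs_zero]
      positivity
  -- On the support `u^{-3/2} ≤ 8` and `u ≤ 4`: the summands bound the value, the derivative falling
  -- on `u^{-3/2} η(u)`, and the derivative falling on `Θ`; the `1` ensures positivity.
  refine ⟨8 * B₀ * C + (12 * B₀ + 32 * B₁) * C + 16 * B₀ * C + 1, by positivity,
    fun κ u hu => ⟨?_, ?_⟩⟩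
  · rw [profile, norm_mul, Complex.norm_real, Real.norm_eq_abs]
    have := mul_le_mul (hg u hu) (hΘ (κ / u ^ 2)).2.1 (norm_nonneg _) (by positivity)
    have h1 : 0 ≤ (12 * B₀ + 32 * B₁) * C + 16 * B₀ * C := by positivity
    linarith
  · have hd1 : HasDerivAt (fun u : ℝ => u ^ (-(3 / 2) : ℝ) * η u)
        (-(3 / 2) * u ^ (-(3 / 2) - 1 : ℝ) * η u + u ^ (-(3 / 2) : ℝ) * deriv η u) u :=
      (Real.hasDerivAt_rpow_const (Or.inl hu.ne')).mul
        (hη.differentiable (by simp) u).hasDerivAt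
    have hd2 : HasDerivAt (fun u : ℝ => κ / u ^ 2) (-(2 * κ / u ^ 3)) u := by
      have h := ((hasDerivAt_pow 2 u).inv (by positivity)).const_mul κ
      refine h.congr_deriv ?_
      push_cast
      field_simp
    have hd := hd1.ofReal_comp.mul ((hΘ (κ / u ^ 2)).1.hasDerivAt.scomp u hd2)
    refine ⟨_, hd, ?_⟩
    have hu1 : u * ‖((-(3 / 2) * u ^ (-(3 / 2) - 1 : ℝ) * η u +
        u ^ (-(3 / 2) : ℝ) * deriv η u : ℝ) : ℂ)‖ ≤ 12 * B₀ + 32 * B₁ := by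
      rw [Complex.norm_real, Real.norm_eq_abs, ← abs_of_pos hu, ← abs_mul, abs_of_pos hu]
      rw [show u * (-(3 / 2) * u ^ (-(3 / 2) - 1 : ℝ) * η u + u ^ (-(3 / 2) : ℝ) * deriv η u) =
        -(3 / 2) * (u ^ (-(3 / 2) : ℝ) * η u) + u ^ (-(3 / 2) : ℝ) * (u * deriv η u) by
          rw [Real.rpow_sub_one hu.ne']; field_simp]
      refine (abs_add_le _ _).trans ?_
      rw [abs_mul]
      have := hg u hu
      have := hg' u hu
      have h0 : |(-(3 / 2) : ℝ)| = 3 / 2 := by rw [abs_neg, abs_of_pos (by norm_num)]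
      rw [h0]; linarith
    have hu2 : u * ‖(-(2 * κ / u ^ 3)) • deriv Θ (κ / u ^ 2)‖ ≤ 2 * C := by
      have h := (hΘ (κ / u ^ 2)).2.2
      rw [norm_smul, Real.norm_eq_abs, abs_neg]
      have h2 : u * |2 * κ / u ^ 3| = 2 * |κ / u ^ 2| := by
        rw [abs_div, abs_div, abs_mul, abs_two, abs_of_pos (by positivity : 0 < u ^ 3),
          abs_of_pos (by positivity : 0 < u ^ 2)]
        field_simp
      rw [← mul_assoc, h2]; linarith
    have hu3 := hg u hu
    calc _ ≤ u * ‖((-(3 / 2) * u ^ (-(3 / 2) - 1 : ℝ) * η u +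
              u ^ (-(3 / 2) : ℝ) * deriv η u : ℝ) : ℂ)‖ * ‖Θ (κ / u ^ 2)‖ +
            |u ^ (-(3 / 2) : ℝ) * η u| * (u * ‖(-(2 * κ / u ^ 3)) • deriv Θ (κ / u ^ 2)‖) := by
          refine (mul_le_mul_of_nonneg_left (norm_add_le _ _) hu.le).trans (le_of_eq ?_)
          rw [norm_mul, norm_mul, Complex.norm_real (u ^ (-(3 / 2) : ℝ) * η u),
            Real.norm_eq_abs]
          simp only [Function.comp]
          ring
      _ ≤ (12 * B₀ + 32 * B₁) * C + 8 * B₀ * (2 * C) := by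
          gcongr
          exact (hΘ _).2.1
      _ ≤ _ := by
          have : 0 ≤ 8 * B₀ * C := by positivity
          linarith

/-- With `u = (2/t)^{1/3}`, the factor `2^{2/3} t^{-2/3} = u²` cancels the `u^{-2}` of the weight
and `√t = √2 u^{-3/2}`. -/
theorem F_eq_profile (η θ : ℝ → ℝ) (M : ℝ) (q h : ℕ) {t : ℝ} (ht : 0 < t) :
    F η θ M q h t = e (1 / 8) * ((Real.sqrt 2 / Real.sqrt 6 : ℝ) : ℂ) *
      profile η (𝓕 (fun x : ℝ => (θ x : ℂ))) (M * h / (q : ℝ) ^ 2)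
        ((2 : ℝ) ^ (1 / 3 : ℝ) * t ^ (-(1 / 3) : ℝ)) := by
  rw [F, tildeTransform, if_pos ht, weight, profile, div_div]
  set u := (2 : ℝ) ^ (1 / 3 : ℝ) * t ^ (-(1 / 3) : ℝ) with hu
  have hu0 : 0 < u := by positivity
  have h1 : (2 : ℝ) ^ (2 / 3 : ℝ) * t ^ (-(2 / 3) : ℝ) = u ^ 2 := by
    rw [hu, mul_pow, ← Real.rpow_natCast, ← Real.rpow_natCast, ← Real.rpow_mul (by norm_num),
      ← Real.rpow_mul ht.le]
    norm_num
  have h2 : Real.sqrt t = Real.sqrt 2 * u ^ (-(3 / 2) : ℝ) := by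
    rw [hu, Real.mul_rpow (by positivity) (by positivity), ← Real.rpow_mul (by norm_num),
      ← Real.rpow_mul ht.le, Real.sqrt_eq_rpow, Real.sqrt_eq_rpow, ← mul_assoc,
      ← Real.rpow_add (by norm_num)]
    norm_num
  rw [h1, h2]
  have h6 : (Real.sqrt 6 : ℂ) ≠ 0 := by
    exact_mod_cast (Real.sqrt_pos.2 (by norm_num)).ne'
  have hu' : (u : ℂ) ≠ 0 := by exact_mod_cast hu0.ne'
  push_cast
  field_simp

/-- `x ↦ F_h(A / x)` is bounded, and has Lipschitz constant `≪ 1 / X` on `[X, ∞)`. -/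
theorem exists_F_lipschitz {b : ℕ} {η θ : ℝ → ℝ} (hw : IsWeightPair b η θ) :
    ∃ D : ℝ, 0 < D ∧ ∀ (M : ℝ) (q h : ℕ) (A X : ℝ), 0 < A → 0 < X →
      (∀ x, X ≤ x → ‖F η θ M q h (A / x)‖ ≤ D) ∧
      ∀ x y, X ≤ x → X ≤ y → ‖F η θ M q h (A / x) - F η θ M q h (A / y)‖ ≤ D / X * |x - y| := by
  have hcs : HasCompactSupport θ :=
    HasCompactSupport.of_support_subset_isCompact isCompact_Icc hw.theta_support
  obtain ⟨C, -, hΘ⟩ := exists_fourier_bound hw.smooth_theta hcs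
  obtain ⟨D, hD, hprof⟩ := exists_profile_bound hw.smooth_eta hw.eta_support hΘ
  refine ⟨D, hD, fun M q h A X hA hX => ?_⟩
  set κ := M * h / (q : ℝ) ^ 2
  set Θ := 𝓕 (fun x : ℝ => (θ x : ℂ))
  set β := (2 : ℝ) ^ (1 / 3 : ℝ) * A ^ (-(1 / 3) : ℝ) with hβ
  have hβ0 : 0 < β := by positivity
  have hF : ∀ x, X ≤ x → F η θ M q h (A / x) =
      e (1 / 8) * ((Real.sqrt 2 / Real.sqrt 6 : ℝ) : ℂ) *
        profile η Θ κ (β * x ^ (1 / 3 : ℝ)) := by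
    intro x hx
    have hx0 : 0 < x := hX.trans_le hx
    rw [F_eq_profile η θ M q h (div_pos hA hx0)]
    congr 2
    rw [hβ, Real.div_rpow hA.le hx0.le, Real.rpow_neg hx0.le]
    field_simp
  have hc : ‖e (1 / 8) * ((Real.sqrt 2 / Real.sqrt 6 : ℝ) : ℂ)‖ ≤ 1 := by
    rw [norm_mul, norm_e, one_mul, Complex.norm_real, Real.norm_eq_abs,
      abs_of_nonneg (by positivity)]
    exact div_le_one_of_le₀ (Real.sqrt_le_sqrt (by norm_num)) (Real.sqrt_nonneg _)
  constructor
  · intro x hx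
    have hx0 : 0 < x := hX.trans_le hx
    rw [hF x hx, norm_mul]
    exact (mul_le_of_le_one_left (norm_nonneg _) hc).trans
      (hprof κ (β * x ^ (1 / 3 : ℝ)) (by positivity)).1
  · have hlip : ∀ x y, X ≤ x → X ≤ y → ‖profile η Θ κ (β * x ^ (1 / 3 : ℝ)) -
        profile η Θ κ (β * y ^ (1 / 3 : ℝ))‖ ≤ D / X * |x - y| := by
      -- The mean value inequality needs a derivative function on all of `ℝ`; below `X` its value is
      -- the dummy `0`. Above, the chain rule turns `u‖w‖ ≤ D` into `D/(3x) ≤ D/X`.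
      have hex : ∀ x, ∃ w : ℂ, X ≤ x →
          HasDerivAt (fun x : ℝ => profile η Θ κ (β * x ^ (1 / 3 : ℝ))) w x ∧ ‖w‖ ≤ D / X := by
        intro x
        by_cases hx : X ≤ x
        · have hx0 : 0 < x := hX.trans_le hx
          obtain ⟨w, hw1, hw2⟩ := (hprof κ (β * x ^ (1 / 3 : ℝ)) (by positivity)).2
          have hd := (Real.hasDerivAt_rpow_const (p := (1 / 3 : ℝ)) (Or.inl hx0.ne')).const_mul β
          refine ⟨_, fun _ => ⟨HasDerivAt.scomp (g₁ := profile η Θ κ) x hw1 hd, ?_⟩⟩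
          rw [norm_smul, Real.norm_eq_abs, abs_of_pos (by positivity), Real.rpow_sub_one hx0.ne']
          rw [show β * (1 / 3 * (x ^ (1 / 3 : ℝ) / x)) * ‖w‖ =
            (β * x ^ (1 / 3 : ℝ) * ‖w‖) / (3 * x) by field_simp]
          exact div_le_div₀ hD.le hw2 hX (by linarith)
        · exact ⟨0, fun h => absurd h hx⟩
      choose w hw using hex
      intro x y hx hy
      exact Convex.norm_image_sub_le_of_norm_hasDerivWithin_le (s := Set.Ici X)
        (fun z hz => (hw z hz).1.hasDerivWithinAt) (fun z hz => (hw z hz).2) (convex_Ici X) hy hx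
    intro x y hx hy
    rw [hF x hx, hF y hy, ← mul_sub, norm_mul]
    exact (mul_le_of_le_one_left (norm_nonneg _) hc).trans (hlip x y hx hy)

/-- The phase left after removing the linear term of `3 K (x₀ + δ)^{1/3}`. -/
theorem abs_remainder_sub_le {K X x₀ B δ δ' : ℝ} (hK : 0 ≤ K) (hX : 0 < X) (hx₀ : X ≤ x₀)
    (hδ : δ ∈ Set.Icc 0 B) (hδ' : δ' ∈ Set.Icc 0 B) :
    |(3 * K * (x₀ + δ) ^ (1 / 3 : ℝ) - K * δ / x₀ ^ (2 / 3 : ℝ)) -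
      (3 * K * (x₀ + δ') ^ (1 / 3 : ℝ) - K * δ' / x₀ ^ (2 / 3 : ℝ))| ≤
      K * B * X ^ (-(5 / 3) : ℝ) * |δ - δ'| := by
  have hx0 : 0 < x₀ := hX.trans_le hx₀
  have hpow : ∀ x, X ≤ x → x ^ (-(5 / 3) : ℝ) ≤ X ^ (-(5 / 3) : ℝ) := fun x hx =>
    Real.rpow_le_rpow_of_nonpos hX hx (by norm_num)
  have hB : 0 ≤ B := hδ.1.trans hδ.2
  have h1 : ∀ y ∈ Set.Icc 0 B, |(x₀ + y) ^ (-(2 / 3) : ℝ) - x₀ ^ (-(2 / 3) : ℝ)| ≤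
      X ^ (-(5 / 3) : ℝ) * B := by
    intro y hy
    have h := Convex.norm_image_sub_le_of_norm_hasDerivWithin_le (s := Set.Ici X)
      (f := fun x : ℝ => x ^ (-(2 / 3) : ℝ)) (f' := fun x => -(2 / 3) * x ^ (-(2 / 3) - 1 : ℝ))
      (C := X ^ (-(5 / 3) : ℝ)) (fun z hz =>
        (Real.hasDerivAt_rpow_const (Or.inl (hX.trans_le hz).ne')).hasDerivWithinAt)
      (fun z hz => by
        have hz0 : 0 < z := hX.trans_le hz
        have := hpow z hz
        rw [show (-(2 / 3) - 1 : ℝ) = -(5 / 3) by norm_num, norm_mul, Real.norm_eq_abs,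
          Real.norm_eq_abs, abs_neg, abs_of_pos (by norm_num : (0 : ℝ) < 2 / 3),
          abs_of_pos (Real.rpow_pos_of_pos hz0 _)]
        have := Real.rpow_pos_of_pos hz0 (-(5 / 3))
        linarith)
      (convex_Ici X) (x := x₀) (y := x₀ + y) hx₀ (by simp only [Set.mem_Ici]; linarith [hy.1])
    rw [Real.norm_eq_abs, Real.norm_eq_abs, add_sub_cancel_left, abs_of_nonneg hy.1] at h
    exact h.trans (mul_le_mul_of_nonneg_left hy.2 (by positivity))
  have h := Convex.norm_image_sub_le_of_norm_hasDerivWithin_le (s := Set.Icc 0 B)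
    (f := fun y : ℝ => 3 * K * (x₀ + y) ^ (1 / 3 : ℝ) - K * y / x₀ ^ (2 / 3 : ℝ))
    (f' := fun y => K * ((x₀ + y) ^ (-(2 / 3) : ℝ) - x₀ ^ (-(2 / 3) : ℝ)))
    (C := K * B * X ^ (-(5 / 3) : ℝ)) (fun z hz => by
      have hz0 : 0 < x₀ + z := by linarith [hz.1]
      have hd1 := ((Real.hasDerivAt_rpow_const (p := (1 / 3 : ℝ)) (Or.inl hz0.ne')).comp z
        ((hasDerivAt_id z).const_add x₀)).const_mul (3 * K)
      have hd2 := ((hasDerivAt_id z).const_mul K).div_const (x₀ ^ (2 / 3 : ℝ))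
      refine ((hd1.sub hd2).congr_deriv ?_).hasDerivWithinAt
      rw [Real.rpow_neg hx0.le, show (1 / 3 - 1 : ℝ) = -(2 / 3) by norm_num]
      ring)
    (fun z hz => by
      rw [norm_mul, Real.norm_eq_abs, Real.norm_eq_abs, abs_of_nonneg hK]
      calc _ ≤ K * (X ^ (-(5 / 3) : ℝ) * B) := mul_le_mul_of_nonneg_left (h1 z hz) hK
        _ = _ := by ring)
    (convex_Icc 0 B) hδ' hδ
  exact h

/-! ### Counting the quadruples -/

/-- With `g = gcd(Q, k)` there are at most `N'/g` second coordinates, and each leaves one class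
modulo `Q/g`, hence at most `Rg` first coordinates. The two factors `g` cancel, so no divisor
function is lost. -/
theorem card_congruence_pairs_le {Q R N' k : ℕ} (hQ : 0 < Q) (S : Finset (ℕ × ℕ))
    (hS : ∀ p ∈ S, p.1 ∈ Finset.Icc 1 (R * Q) ∧ p.2 ∈ Finset.Icc 1 N' ∧
      Nat.gcd Q k ∣ p.2)
    (hcong : ∀ p ∈ S, ∀ p' ∈ S, p.2 = p'.2 → k * p.1 ≡ k * p'.1 [MOD Q]) :
    S.card ≤ R * N' := by
  set g := Nat.gcd Q k with hg
  have hg0 : 0 < g := Nat.gcd_pos_of_pos_left _ hQ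
  obtain ⟨D, hD⟩ : g ∣ Q := Nat.gcd_dvd_left _ _
  have hD0 : 0 < D := by
    rcases Nat.eq_zero_or_pos D with rfl | h
    · omega
    · exact h
  have hQD : Q / g = D := by rw [hD, Nat.mul_div_cancel_left _ hg0]
  have hcard : S.card ≤ (Finset.range (R * g) ×ˢ Finset.Icc 1 (N' / g)).card := by
    refine Finset.card_le_card_of_injOn (fun p => ((p.1 - 1) / D, p.2 / g)) ?_ ?_
    · intro p hp
      obtain ⟨h1, h2, h3⟩ := hS p hp
      rw [Finset.mem_Icc] at h1 h2
      simp only [Finset.coe_product, Set.mem_prod, Finset.mem_coe, Finset.mem_range,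
        Finset.mem_Icc]
      refine ⟨?_, Nat.div_pos (Nat.le_of_dvd h2.1 h3) hg0, Nat.div_le_div_right h2.2⟩
      rw [Nat.div_lt_iff_lt_mul hD0, mul_assoc, ← hD]
      omega
    · intro p hp p' hp' heq
      obtain ⟨h1, h2, h3⟩ := hS p hp
      obtain ⟨h1', h2', h3'⟩ := hS p' hp'
      simp only [Prod.mk.injEq] at heq
      have hn : p.2 = p'.2 := by
        rw [← Nat.div_mul_cancel h3, ← Nat.div_mul_cancel h3', heq.2]
      have hm := (hcong p hp p' hp' hn).cancel_left_div_gcd hQ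
      rw [← hg, hQD] at hm
      rw [Finset.mem_Icc] at h1 h1'
      -- The first coordinate starts at `1`, so quotients are taken of `p.1 - 1`, which makes the
      -- blocks of length `D` exact.
      have hm' : p.1 - 1 ≡ p'.1 - 1 [MOD D] := by
        apply Nat.ModEq.add_right_cancel' 1
        rwa [Nat.sub_add_cancel h1.1, Nat.sub_add_cancel h1'.1]
      have h4 : p.1 - 1 = p'.1 - 1 := by
        rw [← Nat.div_add_mod (p.1 - 1) D, ← Nat.div_add_mod (p'.1 - 1) D, heq.1, hm']
      exact Prod.ext (by omega) hn
  refine hcard.trans ?_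
  rw [Finset.card_product, Finset.card_range, Nat.card_Icc, Nat.add_sub_cancel, mul_assoc]
  exact Nat.mul_le_mul_left _ (Nat.mul_div_le _ _)

/-- For fixed `(h, ℓ)` the pairs `(a, n)` are counted with `k = 2h`: since `ℓ` is a unit modulo `Q`,
`gcd(Q, 2h)` divides `n`, and `n` determines `2ha` modulo `Q`. As `s ∣ Q`, the range of `a` is a
whole number `Q/s` of periods. -/
theorem card_indexSet_le {Q s : ℕ} (hQ : 0 < Q) (hs : s ∣ Q) {σ : ℤ} (hσ : σ = 1 ∨ σ = -1)
    (hlo hhi nlo nhi : ℝ) :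
    (indexSet (Q ^ 2) s σ hlo hhi nlo nhi).card ≤ Q ^ 2 / s * (⌊hhi⌋₊ * ⌊nhi⌋₊) := by
  classical
  set I := indexSet (Q ^ 2) s σ hlo hhi nlo nhi with hI
  have hsq : Nat.sqrt (Q ^ 2) = Q := Nat.sqrt_eq' Q
  have hmem : ∀ p ∈ I, (1 ≤ p.1 ∧ p.1 ≤ Q ^ 2 / s) ∧ (1 ≤ p.2.1 ∧ p.2.1 ≤ ⌊hhi⌋₊) ∧
      (1 ≤ p.2.2.1 ∧ p.2.2.1 ≤ Q) ∧ (1 ≤ p.2.2.2 ∧ p.2.2.2 ≤ ⌊nhi⌋₊) ∧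
      Nat.Coprime (p.1 * p.2.2.1) (Q ^ 2) ∧
      (p.2.2.2 : ℤ) * (p.2.2.1 : ℤ) ^ 3 ≡ -2 * σ * (p.1 : ℤ) * (p.2.1 : ℤ) [ZMOD (Q : ℤ)] := by
    intro p hp
    simp only [hI, indexSet, Finset.mem_filter, Finset.mem_product, Finset.mem_Icc, hsq] at hp
    tauto
  have hdiv : Q ^ 2 / s = Q / s * Q := by
    rw [sq, Nat.mul_div_right_comm hs]
  have h := Finset.card_le_mul_card_image_of_maps_to (s := I)
    (t := Finset.Icc 1 ⌊hhi⌋₊ ×ˢ Finset.Icc 1 Q) (f := fun p => (p.2.1, p.2.2.1))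
    (fun p hp => by
      obtain ⟨_, h2, h3, _⟩ := hmem p hp
      simp [h2, h3]) (Q / s * ⌊nhi⌋₊) (by
      rintro ⟨h, l⟩ _
      set J := I.filter fun p => (p.2.1, p.2.2.1) = (h, l) with hJ
      have hJmem : ∀ p ∈ J, p ∈ I ∧ p.2.1 = h ∧ p.2.2.1 = l := by
        intro p hp
        simpa [hJ] using hp
      have hinj : Set.InjOn (fun p : ℕ × ℕ × ℕ × ℕ => (p.1, p.2.2.2)) J := by
        intro p hp p' hp' heq
        obtain ⟨_, e1, e2⟩ := hJmem p hp
        obtain ⟨_, e1', e2'⟩ := hJmem p' hp'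
        simp only [Prod.mk.injEq] at heq
        exact Prod.ext heq.1 (Prod.ext (e1.trans e1'.symm) (Prod.ext (e2.trans e2'.symm) heq.2))
      rw [← Finset.card_image_of_injOn hinj]
      refine card_congruence_pairs_le (k := 2 * h) hQ _ ?_ ?_
      · intro x hx
        obtain ⟨p, hp, rfl⟩ := Finset.mem_image.1 hx
        obtain ⟨hpI, rfl, rfl⟩ := hJmem p hp
        obtain ⟨h1, h2, h3, h4, h5, h6⟩ := hmem p hpI
        refine ⟨Finset.mem_Icc.2 (by rwa [← hdiv]), Finset.mem_Icc.2 h4, ?_⟩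
        set g := Nat.gcd Q (2 * p.2.1)
        have hgQ : g ∣ Q := Nat.gcd_dvd_left _ _
        have hgh : (g : ℤ) ∣ 2 * (p.2.1 : ℤ) := by
          exact_mod_cast Nat.gcd_dvd_right Q (2 * p.2.1)
        have h7 : (g : ℤ) ∣ (p.2.2.2 : ℤ) * (p.2.2.1 : ℤ) ^ 3 := by
          have h8 := h6.of_dvd (Int.natCast_dvd_natCast.2 hgQ)
          refine h8.dvd_iff.2 ?_
          rw [show -2 * σ * (p.1 : ℤ) * (p.2.1 : ℤ) = 2 * (p.2.1 : ℤ) * (-σ * p.1) by ring]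
          exact hgh.mul_right _
        have h9 : g ∣ p.2.2.2 * p.2.2.1 ^ 3 := by exact_mod_cast h7
        refine Nat.Coprime.dvd_of_dvd_mul_right ?_ h9
        refine Nat.Coprime.pow_right _ (Nat.Coprime.symm ?_)
        exact (h5.coprime_mul_left).coprime_dvd_right (hgQ.trans (dvd_pow_self _ two_ne_zero))
      · intro x hx x' hx' heq
        obtain ⟨p, hp, rfl⟩ := Finset.mem_image.1 hx
        obtain ⟨p', hp', rfl⟩ := Finset.mem_image.1 hx'
        obtain ⟨hpI, e1, e2⟩ := hJmem p hp
        obtain ⟨hpI', e1', e2'⟩ := hJmem p' hp'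
        obtain ⟨-, -, -, -, -, h6⟩ := hmem p hpI
        obtain ⟨-, -, -, -, -, h6'⟩ := hmem p' hpI'
        simp only at heq
        rw [e1, e2] at h6
        rw [e1', e2', ← heq] at h6'
        -- Multiplying by `-σ` removes the sign, since `σ² = 1`.
        have h7 := (h6.symm.trans h6').mul_left (-σ)
        rw [← Int.natCast_modEq_iff]
        have hσ2 : σ * σ = 1 := by rcases hσ with rfl | rfl <;> norm_num
        have e3 : ∀ a : ℤ, -σ * (-2 * σ * a * h) = 2 * h * a := by
          intro a; linear_combination (2 * a * h) * hσ2
        rw [e3, e3] at h7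
        exact_mod_cast h7)
  refine h.trans (le_of_eq ?_)
  rw [Finset.card_product, Nat.card_Icc, Nat.card_Icc, hdiv]
  simp only [Nat.add_sub_cancel]
  ring

/-! ### Extraction of the linear phase and bounds for the amplitude -/

/-- The coefficient `h^{1/3} n^{2/3} / (2^{2/3} q)` of the analytic phase. -/
def phaseCoeff (q h n : ℕ) : ℝ :=
  (h : ℝ) ^ (1 / 3 : ℝ) * (n : ℝ) ^ (2 / 3 : ℝ) / ((2 : ℝ) ^ (2 / 3 : ℝ) * q)

/-- The summand of the `d`-sum after removal of the linear phases, as a function of the increment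
`δ` of `f`. -/
def amplitude (η θ : ℝ → ℝ) (M : ℝ) (q : ℕ) (N x₀ : ℝ) (h n : ℕ) (δ : ℝ) : ℂ :=
  F η θ M q h (N ^ 3 * n / h / (x₀ + δ)) *
    e (3 * phaseCoeff q h n * (x₀ + δ) ^ (1 / 3 : ℝ) -
      phaseCoeff q h n * δ / x₀ ^ (2 / 3 : ℝ))

theorem phaseCoeff_nonneg (q h n : ℕ) : 0 ≤ phaseCoeff q h n := by
  unfold phaseCoeff; positivity

theorem cube_root_factor {q h n : ℕ} {N x : ℝ} (hq : 0 < q) (hN : 0 < N) (hx : 0 ≤ x) :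
    (h * x / (q * N ^ 2)) ^ (1 / 3 : ℝ) * (N * n / (2 * q)) ^ (2 / 3 : ℝ) =
      phaseCoeff q h n * x ^ (1 / 3 : ℝ) := by
  have hq' : (0 : ℝ) < q := by exact_mod_cast hq
  rw [phaseCoeff, Real.div_rpow (by positivity) (by positivity),
    Real.div_rpow (by positivity) (by positivity), Real.mul_rpow (by positivity) hx,
    Real.mul_rpow (by positivity) (by positivity), Real.mul_rpow (by positivity) (by positivity),
    Real.mul_rpow (by positivity) (by positivity)]
  have h1 : (N ^ 2) ^ (1 / 3 : ℝ) = N ^ (2 / 3 : ℝ) := by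
    rw [← Real.rpow_natCast, ← Real.rpow_mul hN.le]; norm_num
  have h2 : (q : ℝ) = (q : ℝ) ^ (1 / 3 : ℝ) * (q : ℝ) ^ (2 / 3 : ℝ) := by
    rw [← Real.rpow_add hq']; norm_num
  rw [h1]
  conv_rhs => rw [h2]
  have := Real.rpow_pos_of_pos hN (2 / 3)
  have := Real.rpow_pos_of_pos hq' (1 / 3)
  have := Real.rpow_pos_of_pos hq' (2 / 3)
  field_simp

/-- The cube of the coefficient is `hn²/(4q³)`, and `MN² = X` turns the bounds on `h` and `n` into
`r³/X` up to a constant. -/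
theorem phaseCoeff_le {q h n : ℕ} {N r M X c₂ c₄ : ℝ} (hq : 0 < q) (hN : 0 < N) (hX : 0 < X)
    (hr : 0 < r) (hM : M = X / N ^ 2) (hc₂ : 0 < c₂) (hc₄ : 0 < c₄)
    (hh : (h : ℝ) ≤ c₂ * (q * r / M)) (hn : (n : ℝ) ≤ c₄ * (q * r / N)) :
    phaseCoeff q h n ≤ (c₂ * c₄ ^ 2 / 4) ^ (1 / 3 : ℝ) * (r * X ^ (-(1 / 3) : ℝ)) := by
  have hq' : (0 : ℝ) < q := by exact_mod_cast hq
  have cube : ∀ x : ℝ, 0 ≤ x → (x ^ 3) ^ (1 / 3 : ℝ) = x := fun x hx => by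
    rw [← Real.rpow_natCast, ← Real.rpow_mul hx]; norm_num
  have h1 : phaseCoeff q h n = (h * (n : ℝ) ^ 2 / (4 * (q : ℝ) ^ 3)) ^ (1 / 3 : ℝ) := by
    rw [Real.div_rpow (by positivity) (by positivity), Real.mul_rpow (by positivity)
      (by positivity), Real.mul_rpow (by positivity) (by positivity), cube _ hq'.le, phaseCoeff,
      show (4 : ℝ) = 2 ^ 2 by norm_num]
    congr 2
    · rw [← Real.rpow_natCast, ← Real.rpow_mul (by positivity)]; norm_num
    · rw [← Real.rpow_natCast, ← Real.rpow_mul (by positivity)]; norm_num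
  have h2 : (c₂ * c₄ ^ 2 / 4) ^ (1 / 3 : ℝ) * (r * X ^ (-(1 / 3) : ℝ)) =
      (c₂ * c₄ ^ 2 / 4 * (r ^ 3 / X)) ^ (1 / 3 : ℝ) := by
    rw [Real.mul_rpow (by positivity) (by positivity),
      Real.div_rpow (x := r ^ 3) (by positivity) hX.le, cube _ hr.le, Real.rpow_neg hX.le]
    rfl
  rw [h1, h2]
  refine Real.rpow_le_rpow (by positivity) ?_ (by norm_num)
  calc h * (n : ℝ) ^ 2 / (4 * (q : ℝ) ^ 3) ≤
        (c₂ * (q * r / M)) * (c₄ * (q * r / N)) ^ 2 / (4 * (q : ℝ) ^ 3) := by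
        have hM0 : 0 < M := hM ▸ by positivity
        gcongr
    _ = _ := by rw [hM]; field_simp

theorem dSum_eq {b : ℕ} (hb : 2 ≤ b) (η θ : ℝ → ℝ) {L q s t : ℕ} {N : ℝ} (σ : ℤ)
    {a h l n : ℕ} (hq : 0 < q) (hqs : q / s = b ^ t) (hN : 0 < N) (ha : a < b ^ t)
    (hf : 0 < f b L a) :
    dSum η θ b L q s N σ a h l n = ‖∑ d ∈ Finset.range s,
      amplitude η θ ((b : ℝ) ^ L / N ^ 2) q N (f b L a) h n (f b L (b ^ t * d)) *
        linearTerm b L q s σ a h l n d‖ := by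
  have hq' : (q : ℝ) ≠ 0 := by positivity
  rw [dSum]
  congr 1
  refine Finset.sum_congr rfl fun d _ => ?_
  have hT : T b L q N (a + d * (q / s)) h =
      h * ((f b L a : ℝ) + f b L (b ^ t * d)) / (q * N ^ 2) := by
    have h1 := f_add hb L ha d
    have h2 : (h : ℝ) * (rho b L (a + b ^ t * d) : ℝ) + (h : ℝ) * ((a + b ^ t * d : ℕ) : ℝ) =
        h * (f b L (a + b ^ t * d) : ℝ) := by
      rw [f]; push_cast; ring
    rw [hqs, mul_comm d, T, h2, h1]; push_cast; rfl
  have hph : phase b L q a h n 0 (d * (q / s)) =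
      phaseCoeff q h n * f b L (b ^ t * d) / (f b L a : ℝ) ^ (2 / 3 : ℝ) := by
    rw [phase, phaseCoeff, hqs, mul_comm d, zero_mul, add_zero, div_mul_eq_mul_div, div_div]
  rw [amplitude, linearTerm, hT, hph, mul_assoc 3, cube_root_factor hq hN (by positivity)]
  have harg : N * n / (q * (h * ((f b L a : ℝ) + f b L (b ^ t * d)) / (q * N ^ 2))) =
      N ^ 3 * n / h / ((f b L a : ℝ) + f b L (b ^ t * d)) := by
    have : (0 : ℝ) < (f b L a : ℝ) + f b L (b ^ t * d) := by positivity
    -- For `h = 0` both sides are `0`, division by zero being zero.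
    rcases Nat.eq_zero_or_pos h with rfl | h0
    · simp
    · field_simp
  rw [harg, mul_mul_mul_comm, ← e_add, sub_add_cancel, mul_assoc 3]

/-- The weight varies at rate `1/X`. The remaining phase has zero derivative at `δ = 0`, so on an
interval of length `≪ Xs/q` its rate is `≪ K (Xs/q) X^{-5/3}`, which is `≪ (rs/q)/X`. -/
theorem exists_amplitude_lipschitz {b : ℕ} {η θ : ℝ → ℝ} (hw : IsWeightPair b η θ) {c₂ c₄ : ℝ}
    (hc₂ : 0 < c₂) (hc₄ : 0 < c₄) :
    ∃ D : ℝ, 0 < D ∧ ∀ (q h n : ℕ) (s N r M X x₀ : ℝ), 0 < q → 0 < h → 0 < n → 0 < s → 0 < N →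
      0 < r → 0 < X → M = X / N ^ 2 → X ≤ x₀ → (h : ℝ) ≤ c₂ * (q * r / M) →
      (n : ℝ) ≤ c₄ * (q * r / N) →
      (∀ δ, 0 ≤ δ → ‖amplitude η θ M q N x₀ h n δ‖ ≤ D) ∧
      ∀ δ ∈ Set.Icc 0 ((b + 1) * X * s / q), ∀ δ' ∈ Set.Icc 0 ((b + 1) * X * s / q),
        ‖amplitude η θ M q N x₀ h n δ - amplitude η θ M q N x₀ h n δ'‖ ≤
          D * (1 + r * s / q) / X * |δ - δ'| := by
  obtain ⟨D, hD, hF⟩ := exists_F_lipschitz hw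
  set κ := (c₂ * c₄ ^ 2 / 4) ^ (1 / 3 : ℝ) with hκ
  have hκ0 : 0 ≤ κ := by positivity
  refine ⟨D * (1 + 2 * Real.pi * (κ * (b + 1))), by positivity, ?_⟩
  intro q h n s N r M X x₀ hq hh hn hs hN hr hX hM hx₀ hhle hnle
  have hq' : (0 : ℝ) < q := by exact_mod_cast hq
  have hh' : (0 : ℝ) < h := by exact_mod_cast hh
  have hn' : (0 : ℝ) < n := by exact_mod_cast hn
  obtain ⟨hF1, hF2⟩ := hF M q h (N ^ 3 * n / h) X (by positivity) hX
  have hpos : 0 ≤ 2 * Real.pi * (κ * (b + 1)) := by positivity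
  constructor
  · intro δ hδ
    rw [amplitude, norm_mul, norm_e, mul_one]
    have := hF1 (x₀ + δ) (by linarith)
    nlinarith
  · intro δ hδ δ' hδ'
    set K := phaseCoeff q h n with hK
    have hK0 : 0 ≤ K := phaseCoeff_nonneg q h n
    have hKle : K ≤ κ * (r * X ^ (-(1 / 3) : ℝ)) :=
      phaseCoeff_le hq hN hX hr hM hc₂ hc₄ hhle hnle
    have h1 := hF2 (x₀ + δ) (x₀ + δ') (by linarith [hδ.1]) (by linarith [hδ'.1])
    rw [add_sub_add_left_eq_sub] at h1
    have h2 := hF1 (x₀ + δ') (by linarith [hδ'.1])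
    have h3 := (norm_e_sub_e_le _ _).trans (mul_le_mul_of_nonneg_left
      (abs_remainder_sub_le hK0 hX hx₀ hδ hδ') (by positivity : 0 ≤ 2 * Real.pi))
    have h4 : K * ((b + 1) * X * s / q) * X ^ (-(5 / 3) : ℝ) ≤ κ * (b + 1) * (r * s / q) / X := by
      calc _ ≤ (κ * (r * X ^ (-(1 / 3) : ℝ))) * ((b + 1) * X * s / q) * X ^ (-(5 / 3) : ℝ) := by
            gcongr
        _ = κ * (b + 1) * (r * s / q) * (X ^ (-(1 / 3) : ℝ) * X * X ^ (-(5 / 3) : ℝ)) := by ring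
        _ = _ := by
            rw [← Real.rpow_add_one hX.ne', ← Real.rpow_add hX,
              show (-(1 / 3) + 1 + -(5 / 3) : ℝ) = -1 by norm_num, Real.rpow_neg_one]
            rfl
    rw [amplitude, amplitude]
    set a₁ := F η θ M q h (N ^ 3 * n / h / (x₀ + δ))
    set a₂ := F η θ M q h (N ^ 3 * n / h / (x₀ + δ'))
    set e₁ := e (3 * K * (x₀ + δ) ^ (1 / 3 : ℝ) - K * δ / x₀ ^ (2 / 3 : ℝ)) with he₁
    set e₂ := e (3 * K * (x₀ + δ') ^ (1 / 3 : ℝ) - K * δ' / x₀ ^ (2 / 3 : ℝ))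
    have he : ‖e₁‖ = 1 := norm_e _
    have h5 : a₁ * e₁ - a₂ * e₂ = (a₁ - a₂) * e₁ + a₂ * (e₁ - e₂) := by ring
    rw [h5]
    have h6 : ‖e₁ - e₂‖ ≤ 2 * Real.pi * (κ * (b + 1) * (r * s / q) / X * |δ - δ'|) := by
      refine h3.trans ?_
      gcongr
    calc _ ≤ ‖a₁ - a₂‖ * ‖e₁‖ + ‖a₂‖ * ‖e₁ - e₂‖ := by
          rw [← norm_mul, ← norm_mul]; exact norm_add_le _ _
      _ ≤ D / X * |δ - δ'| * 1 +
          D * (2 * Real.pi * (κ * (b + 1) * (r * s / q) / X * |δ - δ'|)) := by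
          rw [he]; gcongr
      _ = D * (1 + 2 * Real.pi * (κ * (b + 1)) * (r * s / q)) / X * |δ - δ'| := by ring
      _ ≤ D * ((1 + 2 * Real.pi * (κ * (b + 1))) * (1 + r * s / q)) / X * |δ - δ'| := by
          have : 0 ≤ r * s / q := by positivity
          gcongr
          nlinarith
      _ = _ := by ring

/-! ### Removing the amplitude, and the final estimates -/

theorem le_supFactored {b L q s U : ℕ} {σ : ℤ} (I : Finset (ℕ × ℕ × ℕ × ℕ)) {R γ ξ : ℝ}
    (hγ : γ ∈ Set.Icc (0 : ℝ) 1) (hξ : |ξ| ≤ R) :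
    ∑ p ∈ I, factorU b L q s U σ p.1 p.2.1 p.2.2.1 p.2.2.2 γ ξ *
      factorV b L q s U σ p.1 p.2.1 p.2.2.1 p.2.2.2 γ ξ ≤ supFactored b L q s U σ I R :=
  le_csSup (bddAbove_supFactored b L q s U σ I R) ⟨γ, hγ, ξ, hξ, rfl⟩

theorem supFactored_nonneg {b L q s U : ℕ} {σ : ℤ} (I : Finset (ℕ × ℕ × ℕ × ℕ)) {R : ℝ}
    (hR : 0 ≤ R) : 0 ≤ supFactored b L q s U σ I R :=
  (Finset.sum_nonneg fun _ _ => mul_nonneg (norm_nonneg _) (norm_nonneg _)).trans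
    (le_supFactored I (γ := 0) (ξ := 0) (by simp) (by simpa using hR))

/-- If `G` is bounded and Lipschitz then in the `d`-sum the increment `f (b ^ t d)` may be replaced
by its main part `b ^ (L + 1) ρ_s(d) / q`, and the amplitude removed. -/
theorem sum_norm_sum_amplitude_le {ι : Type*} {I : Finset ι} {b : ℕ} (hb : 2 ≤ b) {L i t : ℕ}
    (hit : i + t ≤ L + 1) (hX : (b : ℝ) ^ (t + i) * b ^ t ≤ (b : ℝ) ^ L)
    {G : ι → ℝ → ℂ} {A : ι → ℕ → ℂ} {D Λ Y : ℝ}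
    (hD : 0 ≤ D) (hΛ : 0 ≤ Λ) (hY0 : 0 ≤ Y) (hA : ∀ p ∈ I, ∀ d, ‖A p d‖ ≤ 1)
    (hG : ∀ p ∈ I, ∀ δ, 0 ≤ δ → ‖G p δ‖ ≤ D)
    (hG' : ∀ p ∈ I, ∀ δ ∈ Set.Icc 0 (((b : ℝ) + 1) * b ^ L / b ^ t),
      ∀ δ' ∈ Set.Icc 0 (((b : ℝ) + 1) * b ^ L / b ^ t), ‖G p δ - G p δ'‖ ≤ Λ * |δ - δ'|)
    (hY : ∀ k < b ^ i, ∑ p ∈ I, ‖∑ d ∈ Finset.range (b ^ i),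
      A p d * e (k / (b ^ i : ℕ) * rhoTrunc b (b ^ i) d : ℝ)‖ ≤ Y) :
    ∑ p ∈ I, ‖∑ d ∈ Finset.range (b ^ i), G p (f b L (b ^ t * d)) * A p d‖ ≤
      (2 * D + Λ * (b * b ^ L / b ^ t)) * (3 + 2 * Real.log (b ^ i : ℕ)) * Y +
        I.card * (b ^ i * (Λ * b ^ (t + i))) := by
  have hb0 : (0 : ℝ) < b := by exact_mod_cast (by omega : 0 < b)
  set ω : ℝ := b * b ^ L / b ^ (t + i) with hω
  have hω0 : 0 < ω := by positivity
  have hωi : ω * (b : ℝ) ^ i = b * b ^ L / b ^ t := by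
    rw [hω, pow_add]; field_simp
  have hf : ∀ d < b ^ i, (f b L (b ^ t * d) : ℝ) =
      ω * rhoTrunc b (b ^ i) d + b ^ t * d := by
    intro d hd
    rw [f, rho_pow_mul hb (by omega) hd]
    push_cast
    congr 2
    rw [hω, eq_div_iff (by positivity), ← pow_succ', ← pow_add]
    congr 1; omega
  have hωR : ∀ v : ℕ, v < b ^ i → ω * v ≤ b * b ^ L / b ^ t := by
    intro v hv
    rw [← hωi]
    have : (v : ℝ) ≤ (b : ℝ) ^ i := by exact_mod_cast hv.le
    gcongr
  have hdR : ∀ d : ℕ, d < b ^ i → (b : ℝ) ^ t * d ≤ b ^ (t + i) := by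
    intro d hd
    rw [pow_add]
    have : (d : ℝ) ≤ (b : ℝ) ^ i := by exact_mod_cast hd.le
    gcongr
  -- This bounds the dropped term `b^t d` and accounts for the `+ 1` in the factor `b + 1` of the
  -- Lipschitz range.
  have hmain : (b : ℝ) ^ (t + i) ≤ b ^ L / b ^ t := (le_div_iff₀ (by positivity)).2 hX
  have hR : ∀ d < b ^ i, rhoTrunc b (b ^ i) d < b ^ i := fun d _ => rhoTrunc_lt hb i d
  have hsplit : ((b : ℝ) + 1) * b ^ L / b ^ t = b * b ^ L / b ^ t + b ^ L / b ^ t := by ring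
  have hnn : (0 : ℝ) ≤ (b : ℝ) ^ L / b ^ t := by positivity
  have hmem : ∀ v : ℕ, v < b ^ i → ω * v ∈ Set.Icc 0 (((b : ℝ) + 1) * b ^ L / b ^ t) := fun v hv =>
    ⟨by positivity, by rw [hsplit]; linarith [hωR v hv]⟩
  have hpoint : ∀ p ∈ I, ‖∑ d ∈ Finset.range (b ^ i), G p (f b L (b ^ t * d)) * A p d‖ ≤
      ‖∑ d ∈ Finset.range (b ^ i), G p (ω * rhoTrunc b (b ^ i) d) * A p d‖ +
        b ^ i * (Λ * b ^ (t + i)) := by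
    intro p hp
    have h1 : ‖∑ d ∈ Finset.range (b ^ i), G p (f b L (b ^ t * d)) * A p d -
        ∑ d ∈ Finset.range (b ^ i), G p (ω * rhoTrunc b (b ^ i) d) * A p d‖ ≤
        b ^ i * (Λ * b ^ (t + i)) := by
      rw [← Finset.sum_sub_distrib]
      refine (norm_sum_le _ _).trans ?_
      refine (Finset.sum_le_sum (g := fun _ => Λ * (b : ℝ) ^ (t + i)) fun d hd => ?_).trans ?_
      · have hd := Finset.mem_range.1 hd
        rw [← sub_mul, norm_mul, hf d hd]
        have h2 := hG' p hp (ω * rhoTrunc b (b ^ i) d + b ^ t * d)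
          ⟨by positivity, by
            rw [hsplit]
            linarith [hωR _ (hR d hd), hdR d hd]⟩
          (ω * rhoTrunc b (b ^ i) d) (hmem _ (hR d hd))
        rw [add_sub_cancel_left, abs_of_nonneg (by positivity)] at h2
        calc _ ≤ ‖G p (ω * rhoTrunc b (b ^ i) d + b ^ t * d) - G p (ω * rhoTrunc b (b ^ i) d)‖ :=
              mul_le_of_le_one_right (norm_nonneg _) (hA p hp d)
          _ ≤ _ := h2
          _ ≤ _ := by gcongr; exact hdR d hd
      · simp
    have h2 := norm_add_le (∑ d ∈ Finset.range (b ^ i), G p (f b L (b ^ t * d)) * A p d -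
        ∑ d ∈ Finset.range (b ^ i), G p (ω * rhoTrunc b (b ^ i) d) * A p d)
        (∑ d ∈ Finset.range (b ^ i), G p (ω * rhoTrunc b (b ^ i) d) * A p d)
    rw [sub_add_cancel] at h2
    linarith
  refine (Finset.sum_le_sum hpoint).trans ?_
  rw [Finset.sum_add_distrib, Finset.sum_const, nsmul_eq_mul]
  gcongr
  refine sum_norm_sum_mul_le (G := fun p v => G p (ω * v)) (R := rhoTrunc b (b ^ i))
    (pow_pos (by omega) _) hR hD (by positivity) hY0
    (fun p hp v _ => hG p hp _ (by positivity)) (fun p hp v hv => ?_) hY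
  -- Consecutive arguments differ by `ω`, so each jump is at most `Λω = V/b^i` with `V = Λ
  -- b·b^L/b^t`.
  refine (hG' p hp _ (hmem _ hv) _ (hmem _ (by omega))).trans (le_of_eq ?_)
  rw [← hωi]
  push_cast
  rw [← mul_sub, add_sub_cancel_left, mul_one, abs_of_pos hω0]
  field_simp

/-- Numerical bound for the cost of separating variables. -/
theorem separation_cost_le {b D q s r X ε c₆ : ℝ} (hb : 0 ≤ b) (hD : 0 ≤ D) (hε : 0 < ε)
    (hc₆ : 0 < c₆) (hs1 : 1 ≤ s) (hsq : s ^ 2 ≤ q) (hsX : s ≤ X) (hX : 1 ≤ X) (hr : 0 ≤ r)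
    (hrq : r ≤ c₆ * (q * X ^ ε)) :
    (2 * D + D * (1 + r * s / q) / X * (b * X * s / q)) * (3 + 2 * Real.log s) ≤
      D * (2 + b * (1 + c₆)) * (3 + 2 / ε) * X ^ (3 * ε) := by
  have hX0 : 0 < X := by linarith
  have hs0 : 0 < s := by linarith
  have hq0 : 0 < q := lt_of_lt_of_le (by positivity) hsq
  have hXε : 1 ≤ X ^ ε := Real.one_le_rpow hX hε.le
  have h1 : (1 + r * s / q) * (s / q) ≤ (1 + c₆) * X ^ ε := by
    have h2 : s / q ≤ 1 := (div_le_one hq0).2 (by nlinarith)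
    -- Here `s² ≤ q` compensates the full factor `q` allowed in `r`.
    have h3 : r * s / q * (s / q) ≤ c₆ * X ^ ε := by
      rw [div_mul_div_comm, div_le_iff₀ (by positivity)]
      calc r * s * s = r * s ^ 2 := by ring
        _ ≤ (c₆ * (q * X ^ ε)) * q := by gcongr
        _ = _ := by ring
    calc _ = s / q + r * s / q * (s / q) := by ring
      _ ≤ 1 + c₆ * X ^ ε := add_le_add h2 h3
      _ ≤ _ := by linarith
  have h2 : 2 * D + D * (1 + r * s / q) / X * (b * X * s / q) ≤
      D * (2 + b * (1 + c₆)) * X ^ ε := by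
    calc _ = 2 * D + D * b * ((1 + r * s / q) * (s / q)) := by field_simp
      _ ≤ 2 * D * X ^ ε + D * b * ((1 + c₆) * X ^ ε) := by
          exact add_le_add (le_mul_of_one_le_right (by positivity) hXε) (by gcongr)
      _ = _ := by ring
  have h3 : 3 + 2 * Real.log s ≤ (3 + 2 / ε) * X ^ ε := by
    have h4 : Real.log s ≤ X ^ ε / ε :=
      (Real.log_le_log hs0 hsX).trans (Real.log_le_rpow_div hX0.le hε)
    calc _ ≤ 3 * X ^ ε + 2 * (X ^ ε / ε) := by linarith
      _ = _ := by ring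
  have h5 : 0 ≤ Real.log s := Real.log_nonneg hs1
  calc _ ≤ (D * (2 + b * (1 + c₆)) * X ^ ε) * ((3 + 2 / ε) * X ^ ε) := by gcongr
    _ = D * (2 + b * (1 + c₆)) * (3 + 2 / ε) * X ^ (2 * ε) := by
        rw [two_mul, Real.rpow_add hX0]; ring
    _ ≤ _ := by
        gcongr ?_ * ?_
        exact Real.rpow_le_rpow_of_exponent_le hX (by linarith)

/-- Numerical bound for the error of replacing `f` by its main part. -/
theorem replacement_error_le {D q s r M N X ε c₂ c₄ c₆ κ : ℝ} (hD : 0 ≤ D) (hε : 0 < ε)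
    (hc₂ : 0 < c₂) (hc₄ : 0 < c₄) (hc₆ : 0 < c₆) (hs1 : 1 ≤ s) (hsq : s ^ 2 ≤ q)
    (hqX : q ^ 2 ≤ X) (hX : 1 ≤ X) (hr : 0 < r) (hM : 0 < M) (hN : 0 < N)
    (hrq : r ≤ c₆ * (q * X ^ ε)) (hκ : κ * s ≤ q * (c₂ * (q * r / M) * (c₄ * (q * r / N)))) :
    M * N / (q * r) ^ (3 / 2 : ℝ) * (κ * (s * (D * (1 + r * s / q) / X * q))) ≤
      c₂ * c₄ * D * (1 + c₆) * (q * Real.sqrt r * X ^ (2 * ε)) := by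
  have hX0 : 0 < X := by linarith
  have hs0 : 0 < s := by linarith
  have hq0 : 0 < q := lt_of_lt_of_le (by positivity) hsq
  have hXε : 1 ≤ X ^ ε := Real.one_le_rpow hX hε.le
  have h1 : 1 + r * s / q ≤ (1 + c₆) * X ^ ε * Real.sqrt q := by
    have h2 : s ≤ Real.sqrt q := Real.le_sqrt_of_sq_le hsq
    have h3 : r * s / q ≤ c₆ * X ^ ε * s := by
      rw [div_le_iff₀ hq0]
      calc r * s ≤ c₆ * (q * X ^ ε) * s := by gcongr
        _ = _ := by ring
    have h4 : 1 ≤ X ^ ε * s := one_le_mul_of_one_le_of_one_le hXε hs1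
    calc _ ≤ X ^ ε * s + c₆ * X ^ ε * s := add_le_add h4 h3
      _ = (1 + c₆) * X ^ ε * s := by ring
      _ ≤ _ := by gcongr
  have h2 : (q * r) ^ (3 / 2 : ℝ) = (q * r) * (Real.sqrt q * Real.sqrt r) := by
    rw [← Real.sqrt_mul hq0.le, Real.sqrt_eq_rpow, ← Real.rpow_one_add' (by positivity)
      (by norm_num)]
    norm_num
  have hsr : 0 < Real.sqrt r := Real.sqrt_pos.2 hr
  have hsq0 : 0 < Real.sqrt q := Real.sqrt_pos.2 hq0
  have hrr : Real.sqrt r * Real.sqrt r = r := Real.mul_self_sqrt hr.le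
  have hqq : Real.sqrt q * Real.sqrt q = q := Real.mul_self_sqrt hq0.le
  calc _ = M * N / (q * r) ^ (3 / 2 : ℝ) * ((κ * s) * (D * (1 + r * s / q) / X * q)) := by ring
    _ ≤ M * N / (q * r) ^ (3 / 2 : ℝ) * ((q * (c₂ * (q * r / M) * (c₄ * (q * r / N)))) *
          (D * ((1 + c₆) * X ^ ε * Real.sqrt q) / X * q)) := by gcongr
    _ = c₂ * c₄ * D * (1 + c₆) * (q ^ 3 * r / (Real.sqrt r * X)) * X ^ ε := by
        rw [h2]; field_simp
    _ = c₂ * c₄ * D * (1 + c₆) * (q * Real.sqrt r * (X ^ ε * (q ^ 2 / X))) := by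
        nth_rewrite 1 [← hrr]; field_simp
    _ ≤ c₂ * c₄ * D * (1 + c₆) * (q * Real.sqrt r * (X ^ ε * X ^ ε)) := by
        gcongr
        exact ((div_le_one hX0).2 hqX).trans hXε
    _ = _ := by rw [two_mul, Real.rpow_add hX0]

theorem norm_linearTerm (b L q s : ℕ) (σ : ℤ) (a h l n d : ℕ) :
    ‖linearTerm b L q s σ a h l n d‖ = 1 := by
  rw [linearTerm, norm_mul, eMod, norm_e, norm_e, one_mul]

end ReversalSum

set_option maxHeartbeats 2000000 in
theorem proposition5p2 (b : ℕ) (hb : 2 ≤ b) (η θ : ℝ → ℝ)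
    (hw : ReversalSum.IsWeightPair b η θ) (ε : ℝ) (hε : 0 < ε)
    -- the implied constants in `h ≍ qr/M`, `n ≍ qr/N`, `X^{2ε} ≪ r ≪ q X^ε`, `N ≪ √X`
    -- and `ξ ≪ X^{2ε}/X`
    (c₁ c₂ c₃ c₄ c₅ c₆ c₇ c₈ : ℝ) (hc₁ : 0 < c₁) (hc₂ : 0 < c₂) (hc₃ : 0 < c₃) (hc₄ : 0 < c₄)
    (hc₅ : 0 < c₅) (hc₆ : 0 < c₆) (hc₇ : 0 < c₇) (hc₈ : 0 < c₈) :
    ∃ C : ℝ, 0 < C ∧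
      ∀ (L lam q s U : ℕ) (N r M X : ℝ) (σ : ℤ) (I : Finset (ℕ × ℕ × ℕ × ℕ)),
        X = (b : ℝ) ^ L →
        Even lam → q = b ^ lam → (q : ℝ) ≤ Real.sqrt X →
        (∃ i : ℕ, s = b ^ i) → (∃ j : ℕ, U = b ^ j) →
        b ∣ U → U ∣ s → s ∣ Nat.sqrt q →
        1 ≤ N → N ≤ c₇ * Real.sqrt X → M = X / N ^ 2 →
        c₅ * X ^ (2 * ε) ≤ r → r ≤ c₆ * ((q : ℝ) * X ^ ε) →
        (σ = 1 ∨ σ = -1) →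
        I = ReversalSum.indexSet q s σ (c₁ * ((q : ℝ) * r / M)) (c₂ * ((q : ℝ) * r / M))
          (c₃ * ((q : ℝ) * r / N)) (c₄ * ((q : ℝ) * r / N)) →
        M * N / ((q : ℝ) * r) ^ (3 / 2 : ℝ) *
            ∑ p ∈ I, ReversalSum.dSum η θ b L q s N σ p.1 p.2.1 p.2.2.1 p.2.2.2 ≤
          C * ((q : ℝ) * Real.sqrt r * X ^ (2 * ε) +
            M * N * X ^ (3 * ε) / ((q : ℝ) * r) ^ (3 / 2 : ℝ) *
              ReversalSum.supFactored b L q s U σ I (c₈ * (X ^ (2 * ε) / X))) := by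
  open ReversalSum in
  obtain ⟨D, hD, hamp⟩ := exists_amplitude_lipschitz hw hc₂ hc₄
  set C₁ := D * (2 + b * (1 + c₆)) * (3 + 2 / ε) with hC₁
  set C₂ := c₂ * c₄ * D * (1 + c₆) with hC₂
  have hC₁0 : 0 < C₁ := by positivity
  have hC₂0 : 0 < C₂ := by positivity
  refine ⟨C₁ + C₂, by positivity, ?_⟩
  rintro L lam q s U N r M X σ I hX ⟨m, rfl⟩ hq hqX ⟨i, hs⟩ ⟨j, hU⟩ hbU hUs hsq hN - hM hr hrq
    hσ hI
  have hb1 : 1 < b := hb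
  have hb0 : 0 < b := by omega
  have hbR : (1 : ℝ) ≤ b := by exact_mod_cast hb0
  have hbpos : (0 : ℝ) < b := by linarith
  have hX1 : 1 ≤ X := hX ▸ one_le_pow₀ hbR
  have hX0 : 0 < X := by linarith
  have hN0 : 0 < N := by linarith
  have hM0 : 0 < M := hM ▸ by positivity
  have hr0 : 0 < r := lt_of_lt_of_le (by positivity) hr
  have hqQ : q = (b ^ m) ^ 2 := by rw [hq, ← pow_mul, mul_two]
  have hsqrt : Nat.sqrt q = b ^ m := by rw [hqQ, Nat.sqrt_eq']
  rw [hsqrt] at hsq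
  have hj1 : 1 ≤ j := by
    rcases Nat.eq_zero_or_pos j with rfl | h
    · rw [hU, pow_zero, Nat.dvd_one] at hbU; omega
    · exact h
  have hji : j ≤ i := by rw [hU, hs] at hUs; exact (Nat.pow_dvd_pow_iff_le_right hb1).1 hUs
  have him : i ≤ m := by rw [hs] at hsq; exact (Nat.pow_dvd_pow_iff_le_right hb1).1 hsq
  obtain ⟨i', rfl⟩ : ∃ i', i = i' + j := ⟨i - j, by omega⟩
  obtain ⟨t, ht⟩ : ∃ t, m + m = i' + j + t := ⟨m + m - (i' + j), by omega⟩
  have hq' : q = b ^ (i' + j + t) := by rw [hq, ht]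
  have hq0 : 0 < q := hq' ▸ pow_pos hb0 _
  have hqR0 : (0 : ℝ) < q := by exact_mod_cast hq0
  have hqs : q / s = b ^ t := by
    rw [hq', hs, pow_add _ (i' + j), Nat.mul_div_cancel_left _ (pow_pos hb0 _)]
  have hqX2 : (q : ℝ) ^ 2 ≤ X := (Real.le_sqrt hqR0.le hX0.le).1 hqX
  have hlamL : 2 * (i' + j + t) ≤ L := by
    have : b ^ (2 * (i' + j + t)) ≤ b ^ L := by
      rw [hX, hq'] at hqX2
      rw [mul_comm, pow_mul]
      exact_mod_cast hqX2
    exact (Nat.pow_le_pow_iff_right hb1).1 this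
  have hs1 : (1 : ℝ) ≤ s := by rw [hs]; exact_mod_cast Nat.one_le_pow _ _ hb0
  have hs2q : (s : ℝ) ^ 2 ≤ q := by
    rw [hqQ, hs]
    exact_mod_cast Nat.pow_le_pow_left (Nat.pow_le_pow_right hb0 him) 2
  have hq1 : (1 : ℝ) ≤ q := by exact_mod_cast hq0
  have hsX : (s : ℝ) ≤ X := by nlinarith
  set Y := supFactored b L q s U σ I (c₈ * (X ^ (2 * ε) / X)) with hY
  have hY0 : 0 ≤ Y := supFactored_nonneg I (by positivity)
  have hmem : ∀ p ∈ I, p.1 < b ^ t ∧ p.1 % b ≠ 0 ∧ Nat.Coprime p.2.2.1 q ∧ 0 < p.2.1 ∧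
      0 < p.2.2.2 ∧ (p.2.1 : ℝ) ≤ c₂ * (q * r / M) ∧ (p.2.2.2 : ℝ) ≤ c₄ * (q * r / N) := by
    intro p hp
    simp only [hI, indexSet, Finset.mem_filter, Finset.mem_product, Finset.mem_Icc, hqs] at hp
    obtain ⟨⟨⟨-, ha⟩, ⟨hh, hh'⟩, -, hn, hn'⟩, -, -, hcop, -⟩ := hp
    have hbq : b ∣ q := hq' ▸ dvd_pow_self _ (by omega)
    have hab : ¬ b ∣ p.1 := fun hdvd => by
      have := Nat.dvd_gcd (hdvd.mul_right p.2.2.1) hbq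
      rw [hcop] at this
      have := Nat.le_of_dvd one_pos this
      omega
    -- The endpoint `a = q/s = b^t` is excluded by coprimality: `t ≥ 1`, because `s ≤ √q` and `b ∣
    -- s`.
    refine ⟨lt_of_le_of_ne ha fun h => hab (h ▸ dvd_pow_self _ (by omega)),
      fun h => hab (Nat.dvd_of_mod_eq_zero h), hcop.coprime_mul_left, hh, hn, ?_, ?_⟩
    · exact (Nat.cast_le.2 hh').trans (Nat.floor_le (by positivity))
    · exact (Nat.cast_le.2 hn').trans (Nat.floor_le (by positivity))
  have hdsum : ∀ p ∈ I, dSum η θ b L q s N σ p.1 p.2.1 p.2.2.1 p.2.2.2 =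
      ‖∑ d ∈ Finset.range (b ^ (i' + j)),
        amplitude η θ M q N (f b L p.1) p.2.1 p.2.2.2 (f b L (b ^ t * d)) *
          linearTerm b L q s σ p.1 p.2.1 p.2.2.1 p.2.2.2 d‖ := by
    intro p hp
    obtain ⟨ha, hab, -⟩ := hmem p hp
    rw [dSum_eq hb η θ σ hq0 hqs hN0 ha ((pow_pos hb0 L).trans_le (pow_le_f hab)), ← hX, ← hM,
      ← hs]
  set Λ := D * (1 + r * s / q) / X with hΛ
  have hampI : ∀ p ∈ I, _ := fun p hp => by
    obtain ⟨-, hab, -, hh, hn, hh', hn'⟩ := hmem p hp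
    have hf0 : X ≤ (f b L p.1 : ℝ) := by
      rw [hX]; exact_mod_cast pow_le_f hab
    exact hamp q p.2.1 p.2.2.2 s N r M X (f b L p.1) hq0 hh hn (by linarith) hN0 hr0 hX0 hM hf0
      hh' hn'
  have hsR : (s : ℝ) = (b : ℝ) ^ (i' + j) := by rw [hs]; push_cast; rfl
  have hqR : (q : ℝ) = (b : ℝ) ^ (t + (i' + j)) := by rw [hq', add_comm t]; push_cast; rfl
  have hrange : ((b : ℝ) + 1) * X * s / q = ((b : ℝ) + 1) * b ^ L / b ^ t := by
    rw [hX, hsR, hqR, pow_add _ t]; field_simp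
  have hrange' : (b : ℝ) * X * s / q = (b : ℝ) * b ^ L / b ^ t := by
    rw [hX, hsR, hqR, pow_add _ t]; field_simp
  have hsum := sum_norm_sum_amplitude_le (I := I) hb (L := L) (i := i' + j) (t := t) (by omega)
    (by rw [← pow_add]; exact pow_le_pow_right₀ hbR (by omega))
    (G := fun p => amplitude η θ M q N (f b L p.1) p.2.1 p.2.2.2)
    (A := fun p => linearTerm b L q s σ p.1 p.2.1 p.2.2.1 p.2.2.2) (D := D) (Λ := Λ) (Y := Y)
    hD.le (by positivity) hY0 (fun p _ d => (norm_linearTerm ..).le)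
    (fun p hp => (hampI p hp).1) (fun p hp => by
      have := (hampI p hp).2
      rwa [hrange] at this) (by
      intro k hk
      have hk' : (k : ℝ) ≤ (b ^ (i' + j) : ℕ) := by exact_mod_cast hk.le
      -- The frequency `k` of the expansion modulo `s` is the parameter `γ = k/s` of the supremum,
      -- with `ξ = 0`.
      refine le_trans (le_of_eq ?_) (le_supFactored (b := b) (L := L) (q := q) (s := s) (U := U)
        (σ := σ) I (R := c₈ * (X ^ (2 * ε) / X)) (γ := k / (b ^ (i' + j) : ℕ)) (ξ := 0)
        ⟨by positivity, div_le_one_of_le₀ hk' (by positivity)⟩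
        (by rw [abs_zero]; positivity))
      refine Finset.sum_congr rfl fun p hp => ?_
      have hcop : Nat.Coprime p.2.2.1 (b ^ (i' + j)) :=
        (hmem p hp).2.2.1.coprime_dvd_right (hq' ▸ pow_dvd_pow _ (by omega))
      have := norm_sum_linearTerm hb L (t := t) σ p.1 p.2.1 p.2.2.1 p.2.2.2 hcop
        (k / (b ^ (i' + j) : ℕ))
      rw [← hq', ← hs, ← hU] at this
      rw [← hs]
      exact this)
  rw [← Finset.sum_congr rfl hdsum, ← hrange', ← hs, ← hsR, ← hqR] at hsum
  have hcard : (I.card : ℝ) * s ≤ q * (c₂ * (q * r / M) * (c₄ * (q * r / N))) := by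
    have h1 : I.card ≤ q / s * (⌊c₂ * (q * r / M)⌋₊ * ⌊c₄ * (q * r / N)⌋₊) := by
      rw [hI]
      have := card_indexSet_le (pow_pos hb0 m) hsq hσ (c₁ * (q * r / M)) (c₂ * (q * r / M))
        (c₃ * (q * r / N)) (c₄ * (q * r / N))
      rwa [← hqQ] at this
    have h2 : (I.card : ℝ) ≤ (q / s : ℕ) * (c₂ * (q * r / M) * (c₄ * (q * r / N))) := by
      refine (Nat.cast_le.2 h1).trans ?_
      push_cast
      have e1 := Nat.floor_le (a := c₂ * (q * r / M)) (by positivity)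
      have e2 := Nat.floor_le (a := c₄ * (q * r / N)) (by positivity)
      gcongr
    have h3 : ((q / s : ℕ) : ℝ) * s ≤ q := by exact_mod_cast Nat.div_mul_le_self q s
    calc (I.card : ℝ) * s ≤
          ((q / s : ℕ) * (c₂ * (q * r / M) * (c₄ * (q * r / N)))) * s := by gcongr
      _ = ((q / s : ℕ) * s) * (c₂ * (q * r / M) * (c₄ * (q * r / N))) := by ring
      _ ≤ _ := by gcongr
  have hcost := separation_cost_le hbpos.le hD.le hε hc₆ hs1 hs2q hsX hX1 hr0.le hrq
  have herr := replacement_error_le hD.le hε hc₂ hc₄ hc₆ hs1 hs2q hqX2 hX1 hr0 hM0 hN0 hrq hcard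
  rw [← hΛ] at hcost herr
  calc _ ≤ M * N / ((q : ℝ) * r) ^ (3 / 2 : ℝ) *
        ((2 * D + Λ * (b * X * s / q)) * (3 + 2 * Real.log s) * Y +
          I.card * (s * (Λ * q))) := by gcongr
    _ ≤ M * N / ((q : ℝ) * r) ^ (3 / 2 : ℝ) * (C₁ * X ^ (3 * ε) * Y) +
        C₂ * (q * Real.sqrt r * X ^ (2 * ε)) := by
        rw [mul_add]
        gcongr
    _ = C₁ * (M * N * X ^ (3 * ε) / ((q : ℝ) * r) ^ (3 / 2 : ℝ) * Y) +
        C₂ * (q * Real.sqrt r * X ^ (2 * ε)) := by ring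
    _ ≤ _ := by
        have e1 : 0 ≤ M * N * X ^ (3 * ε) / ((q : ℝ) * r) ^ (3 / 2 : ℝ) * Y := by positivity
        have e2 : 0 ≤ q * Real.sqrt r * X ^ (2 * ε) := by positivity
        nlinarith

end
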